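/- **Conventions.** For a finite-dimensional C*-algebra $B$ with a faithful positive functional $\psi$, put $\langle a,b\rangle_\psi=\psi(a^*b)$, and on $B\otimes B$ use $\psi\otimes\psi$; all adjoints are taken with respect to these inner products. The pair $(B,\psi)$ is a *quantum set* if the multiplication $m:B\otimes B\to B$ satisfies $mm^*=\mathrm{Id}_B$; for instance $(M_2,2\mathrm{Tr})$, and $(\mathbb C^V,\psi_V)$ with $\psi_V(f)=\sum_{v\in V}f(v)$ for a finite set $V$. A *quantum graph* on $(B,\psi)$ is a linear map $A:B\to B$ with $m(A\otimes A)m^*=A$ and $A(b^*)=A(b)^*$ for all $b$. It is *undirected* if $A=A^*$ and *loopfree* if $m(A\otimes\mathrm{Id})m^*=0$. A classical graph on $V$ is identified with its adjacency matrix, a quantum graph on $(\mathbb C^V,\psi_V)$. Quantum graphs $A_1$ on $(B_1,\psi_1)$ and $A_2$ on $(B_2,\psi_2)$ are *isomorphic* if there is a $*$-isomorphism $\varphi:B_1\to B_2$ with $\psi_2\varphi=\psi_1$ and $\varphi A_1=A_2\varphi$. They are *quantum isomorphic*, $A_1\cong_q A_2$, if there are a nonzero finite-dimensional Hilbert space $H$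 and a unital $*$-homomorphism $\rho:B_1\to B_2\otimes B(H)$ such that $a\otimes\xi\mapsto\rho(a)(1\otimes\xi)$ defines a unitary $L^2(B_1,\psi_1)\otimes H\to L^2(B_2,\psi_2)\otimes H$ and $\rho A_1=(A_2\otimes\mathrm{Id}_{B(H)})\rho$. Let $G$ be a finite abelian group with dual $\hat G$, let $n=|G|$, and let $\hat\alpha$ be an action of $\hat G$ on a quantum set $(\tilde B,\tilde\psi)$ by $\tilde\psi$-preserving $*$-automorphisms. The crossed product $\tilde B\rtimes_{\hat\alpha}\hat G$ consists of the sums $\sum_\chi b_\chi u_\chi$ with $b_\chi\in\tilde B$, where $(bu_\chi)(cu_\xi)=b\,\hat\alpha_\chi(c)u_{\chi\xi}$ and $(bu_\chi)^*=\hat\alpha_{\chi^{-1}}(b^*)u_{\chi^{-1}}$. It carries the functional $\psi_\rtimes(\sum_\chi b_\chi u_\chi)=n\tilde\psi(b_1)$ and the map $E(\sum_\chi b_\chi u_\chi)=n\,b_1$ to $\tilde B$. A *voltage quantum graph* with respect to $\hat\alpha$ is a family $\tilde A=(\tilde A_g)_{g\in G}$ of quantum graphs on $(\tilde B,\tilde\psi)$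 commuting with every $\hat\alpha_\chi$. Its *derived quantum graph* is $$\tilde A\rtimes_{\hat\alpha}\hat G=\sum_{g\in G}m\,(X_g\otimes E^*\tilde A_gE)\,m^*,\qquad X_g(b)=\frac1n\sum_{\chi\in\hat G}\overline{\chi(g)}\,\langle u_\chi,b\rangle_{\psi_\rtimes}\,u_\chi .$$ A classical $G$-voltage graph on $V$ is a finite directed graph on $V$ (loops and multiple edges allowed) whose edges are labelled by elements of $G$. It is *pre-simple* if for all $u,v\in V$ and $g\in G$ there is at most one edge $u\to v$ labelled $g$; then $\tilde A_g$ denotes the adjacency matrix of the subgraph of the edges labelled $g$. **Proposition.** Let $A$ be an undirected loopfree quantum graph on $(M_2,2\mathrm{Tr})$, and let $\hat\alpha$ be the action of $\hat{\mathbb Z}_2$ on $(\mathbb C^2,\psi_2)$ in which the nontrivial character swaps the two coordinates. 1. There is a pre-simple classical $\mathbb Z_2$-voltage graph on two vertices whose family $\tilde A=(\tilde A_0,\tilde A_1)$ is a voltage quantum graph on $(\mathbb C^2,\psi_2)$ with respect to $\hat\alpha$, such that $\tilde A\rtimes_{\hat\alpha}\hat{\mathbb Z}_2$ is a quantum graph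 on the quantum set $(\mathbb C^2\rtimes_{\hat\alpha}\hat{\mathbb Z}_2,\psi_\rtimes)$ and $A$ is isomorphic to it. 2. There is a simple graph $\Delta$ on four vertices (undirected, without loops), with adjacency matrix $A_\Delta$ on $(\mathbb C^4,\psi_4)$, such that $A\cong_q A_\Delta$ and $A_\Delta\cong_q A$. -/

import Mathlib

open scoped TensorProduct

noncomputable section

/-! ### Finite quantum sets and quantum graphs

A finite-dimensional C*-algebra with a faithful positive functional is given here as a
finite-dimensional unital complex star-algebra `B` with a linear functional `ψ` satisfying
`ψ (b* b) ≥ 0`, with equality only for `b = 0`.  No norm is recorded: such a star-algebra is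
faithfully represented on its GNS space, hence carries a (unique) C*-norm. -/

section QuantumSets

variable {B B₁ B₂ : Type*}
  [Ring B] [StarRing B] [Algebra ℂ B] [StarModule ℂ B]
  [Ring B₁] [StarRing B₁] [Algebra ℂ B₁] [StarModule ℂ B₁]
  [Ring B₂] [StarRing B₂] [Algebra ℂ B₂] [StarModule ℂ B₂]

/-- The GNS inner product `⟨x, y⟩_ψ = ψ (x* y)`. -/
def gnsInner (ψ : B →ₗ[ℂ] ℂ) (x y : B) : ℂ := ψ (star x * y)

/-- `S` is an adjoint of `T` for the inner products induced by `ψ₁` and `ψ₂`. -/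
def IsGNSAdjoint (ψ₁ : B₁ →ₗ[ℂ] ℂ) (ψ₂ : B₂ →ₗ[ℂ] ℂ) (T : B₁ →ₗ[ℂ] B₂) (S : B₂ →ₗ[ℂ] B₁) : Prop :=
  ∀ x y, gnsInner ψ₂ (T x) y = gnsInner ψ₁ x (S y)

open Classical in
/-- The adjoint `T*` of `T : L²(B₁, ψ₁) → L²(B₂, ψ₂)`.  (It exists and is unique when the algebras
are finite-dimensional and the functionals are faithful and positive; the value is `0` if there
is no adjoint.) -/
def gnsAdjoint (ψ₁ : B₁ →ₗ[ℂ] ℂ) (ψ₂ : B₂ →ₗ[ℂ] ℂ) (T : B₁ →ₗ[ℂ] B₂) : B₂ →ₗ[ℂ] B₁ :=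
  if h : ∃ S, IsGNSAdjoint ψ₁ ψ₂ T S then h.choose else 0

/-- The functional `ψ ⊗ ψ` on `B ⊗ B`. -/
def tensorFunctional (ψ : B →ₗ[ℂ] ℂ) : B ⊗[ℂ] B →ₗ[ℂ] ℂ :=
  LinearMap.mul' ℂ ℂ ∘ₗ TensorProduct.map ψ ψ

/-- The comultiplication `m* : B → B ⊗ B`, the adjoint of the multiplication map `m`. -/
def comulMap (ψ : B →ₗ[ℂ] ℂ) : B →ₗ[ℂ] B ⊗[ℂ] B :=
  gnsAdjoint (tensorFunctional ψ) ψ (LinearMap.mul' ℂ B)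

/-- `(B, ψ)` is a quantum set: `B` is finite-dimensional, `ψ` is a faithful positive functional,
and `m m* = Id`. -/
structure IsQuantumSet (ψ : B →ₗ[ℂ] ℂ) : Prop where
  finiteDimensional : FiniteDimensional ℂ B
  nonneg : ∀ b, 0 ≤ (ψ (star b * b)).re ∧ (ψ (star b * b)).im = 0
  faithful : ∀ b, ψ (star b * b) = 0 → b = 0
  mul_comul : LinearMap.mul' ℂ B ∘ₗ comulMap ψ = LinearMap.id

/-- The Schur product `m (S ⊗ T) m*` of two linear maps on `B`. -/
def schurMul (ψ : B →ₗ[ℂ] ℂ) (S T : B →ₗ[ℂ] B) : B →ₗ[ℂ] B :=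
  LinearMap.mul' ℂ B ∘ₗ TensorProduct.map S T ∘ₗ comulMap ψ

/-- `A` is a quantum adjacency matrix (a quantum graph) on `(B, ψ)`. -/
structure IsQuantumGraph (ψ : B →ₗ[ℂ] ℂ) (A : B →ₗ[ℂ] B) : Prop where
  schur_idempotent : schurMul ψ A A = A
  map_star : ∀ b, A (star b) = star (A b)

/-- Undirected quantum graphs: `A = A*`. -/
def IsUndirected (ψ : B →ₗ[ℂ] ℂ) (A : B →ₗ[ℂ] B) : Prop := A = gnsAdjoint ψ ψ A

/-- Loopfree quantum graphs: `m (A ⊗ Id) m* = 0`. -/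
def IsLoopfree (ψ : B →ₗ[ℂ] ℂ) (A : B →ₗ[ℂ] B) : Prop := schurMul ψ A LinearMap.id = 0

/-- Isomorphism of quantum graphs: a star-isomorphism of the algebras that preserves the
functionals and intertwines the quantum adjacency matrices. -/
def QuantumGraphIsomorphic (ψ₁ : B₁ →ₗ[ℂ] ℂ) (A₁ : B₁ →ₗ[ℂ] B₁)
    (ψ₂ : B₂ →ₗ[ℂ] ℂ) (A₂ : B₂ →ₗ[ℂ] B₂) : Prop :=
  ∃ φ : B₁ ≃⋆ₐ[ℂ] B₂, (∀ b, ψ₂ (φ b) = ψ₁ b) ∧ ∀ b, φ (A₁ b) = A₂ (φ b)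

/-! ### Quantum isomorphism

For the Hilbert space `H = ℂ^d` we write `B ⊗ B(H)` as the star-algebra of `d × d` matrices over
`B`, and `L²(B) ⊗ H` as the space of `d`-tuples of elements of `B`
(the tuple `x` stands for `∑ i, x i ⊗ e_i`). -/

/-- The inner product of `L²(B, ψ) ⊗ ℂ^d`. -/
def ampInner {d : ℕ} (ψ : B →ₗ[ℂ] ℂ) (x y : Fin d → B) : ℂ := ∑ i, gnsInner ψ (x i) (y i)

/-- The linear map `p : L²(B₁) ⊗ ℂ^d → L²(B₂) ⊗ ℂ^d`, `a ⊗ ξ ↦ ρ(a) (1 ⊗ ξ)`; on tuples,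
`∑ j, x j ⊗ e_j ↦ ∑ j, ρ(x j) (1 ⊗ e_j) = ∑ i, (∑ j, ρ(x j)_{i j}) ⊗ e_i`. -/
def ampMap {d : ℕ} (ρ : B₁ →⋆ₐ[ℂ] Matrix (Fin d) (Fin d) B₂) (x : Fin d → B₁) : Fin d → B₂ :=
  fun i => ∑ j, ρ (x j) i j

/-- `ρ : B₁ → B₂ ⊗ B(ℂ^d)` is a quantum isomorphism of quantum sets: it is a unital
star-homomorphism (by its type) and `p` is unitary. -/
structure IsQuantumIso {d : ℕ} (ψ₁ : B₁ →ₗ[ℂ] ℂ) (ψ₂ : B₂ →ₗ[ℂ] ℂ)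
    (ρ : B₁ →⋆ₐ[ℂ] Matrix (Fin d) (Fin d) B₂) : Prop where
  bijective : Function.Bijective (ampMap ρ)
  inner_map : ∀ x y, ampInner ψ₂ (ampMap ρ x) (ampMap ρ y) = ampInner ψ₁ x y

/-- Quantum isomorphism of quantum graphs: there are a nonzero finite-dimensional Hilbert space
`ℂ^d` and a quantum isomorphism `ρ` of the quantum sets with `ρ A₁ = (A₂ ⊗ Id) ρ`. -/
def QuantumGraphQuantumIsomorphic (ψ₁ : B₁ →ₗ[ℂ] ℂ) (A₁ : B₁ →ₗ[ℂ] B₁)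
    (ψ₂ : B₂ →ₗ[ℂ] ℂ) (A₂ : B₂ →ₗ[ℂ] B₂) : Prop :=
  ∃ (d : ℕ) (ρ : B₁ →⋆ₐ[ℂ] Matrix (Fin d) (Fin d) B₂),
    0 < d ∧ IsQuantumIso ψ₁ ψ₂ ρ ∧ ∀ b, ρ (A₁ b) = (ρ b).map A₂

end QuantumSets

/-! ### Crossed products by finite groups -/

/-- The underlying space of the crossed product `B ⋊_α Γ`: the function `x` stands for
`∑ χ, x χ u_χ`. -/
def CrossedProduct {B Γ : Type*} [Ring B] [StarRing B] [Algebra ℂ B] [Group Γ]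
    (_α : Γ →* (B ≃⋆ₐ[ℂ] B)) : Type _ := Γ → B

namespace CrossedProduct

variable {B Γ : Type*} [Ring B] [StarRing B] [Algebra ℂ B] [Group Γ] {α : Γ →* (B ≃⋆ₐ[ℂ] B)}

instance (priority := 10) instAddCommGroup : AddCommGroup (CrossedProduct α) := inferInstanceAs (AddCommGroup (Γ → B))

instance (priority := 10) instSMul : SMul ℂ (CrossedProduct α) := inferInstanceAs (SMul ℂ (Γ → B))

@[ext] theorem ext {x y : CrossedProduct α} (h : ∀ χ, x χ = y χ) : x = y := funext h

@[simp] theorem add_apply (x y : CrossedProduct α) (χ : Γ) : (x + y) χ = x χ + y χ := rfl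

@[simp] theorem zero_apply (χ : Γ) : (0 : CrossedProduct α) χ = 0 := rfl

@[simp] theorem smul_apply (c : ℂ) (x : CrossedProduct α) (χ : Γ) : (c • x) χ = c • x χ := rfl

open Classical in
/-- The element `b u_χ`. -/
def single (χ : Γ) (b : B) : CrossedProduct α := Pi.single χ b

/-- The canonical unitaries `u_χ`. -/
def u (χ : Γ) : CrossedProduct α := single χ 1

theorem map_mul_act (χ ξ : Γ) (b : B) : α (χ * ξ) b = α χ (α ξ b) := by
  rw [map_mul]; rfl

theorem map_one_act (b : B) : α 1 b = b := by
  rw [map_one]; rfl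

theorem act_inv_act (χ : Γ) (b : B) : α χ ((α χ)⁻¹ b) = b := by
  rw [← map_inv, ← map_mul_act, mul_inv_cancel, map_one_act]

/-- The involution `(b u_χ)* = α_{χ⁻¹}(b*) u_{χ⁻¹}`. -/
instance : Star (CrossedProduct α) := ⟨fun x η => α η (star (x η⁻¹))⟩

theorem star_apply (x : CrossedProduct α) (η : Γ) : star x η = α η (star (x η⁻¹)) := rfl

instance : One (CrossedProduct α) := ⟨u 1⟩

open Classical in
theorem one_apply (η : Γ) : (1 : CrossedProduct α) η = if η = 1 then 1 else 0 := by
  change (Pi.single (1 : Γ) (1 : B) : Γ → B) η = _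
  exact Pi.single_apply _ _ _

variable [Fintype Γ]

/-- The multiplication `(b u_χ) (c u_ξ) = b α_χ(c) u_{χ ξ}`. -/
instance : Mul (CrossedProduct α) := ⟨fun x y η => ∑ χ, x χ * α χ (y (χ⁻¹ * η))⟩

theorem mul_apply (x y : CrossedProduct α) (η : Γ) :
    (x * y) η = ∑ χ, x χ * α χ (y (χ⁻¹ * η)) := rfl

instance : Ring (CrossedProduct α) :=
  { (inferInstance : AddCommGroup (CrossedProduct α)),
    (inferInstance : Mul (CrossedProduct α)),
    (inferInstance : One (CrossedProduct α)) with
    left_distrib := fun x y z => by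
      ext η; simp [mul_apply, mul_add, Finset.sum_add_distrib]
    right_distrib := fun x y z => by
      ext η; simp [mul_apply, add_mul, Finset.sum_add_distrib]
    zero_mul := fun x => by ext η; simp [mul_apply]
    mul_zero := fun x => by ext η; simp [mul_apply]
    one_mul := fun x => by
      ext η
      rw [mul_apply, Finset.sum_eq_single 1]
      · simp [one_apply]
      · intro χ _ h; simp [one_apply, h]
      · simp
    mul_one := fun x => by
      ext η
      rw [mul_apply, Finset.sum_eq_single η]
      · simp [one_apply]
      · intro χ _ h
        have : χ⁻¹ * η ≠ 1 := fun h' => h (by rw [inv_mul_eq_one] at h'; exact h')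
        simp [one_apply, this]
      · simp
    mul_assoc := fun x y z => by
      ext η
      simp only [mul_apply, map_sum, map_mul, Finset.mul_sum, Finset.sum_mul]
      rw [Finset.sum_comm]
      refine Finset.sum_congr rfl fun χ _ => ?_
      rw [← Equiv.sum_comp (Equiv.mulLeft χ)]
      refine Finset.sum_congr rfl fun ξ _ => ?_
      simp only [Equiv.coe_mulLeft, inv_mul_cancel_left, map_mul_act, mul_inv_rev, mul_assoc] }

instance : StarRing (CrossedProduct α) where
  star_involutive x := by
    ext η
    simp [star_apply, ← map_star, act_inv_act]
  star_add x y := by ext η; simp [star_apply]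
  star_mul x y := by
    ext η
    simp only [star_apply, mul_apply, star_sum, star_mul, map_sum, map_mul]
    rw [← Equiv.sum_comp (Equiv.mulLeft η⁻¹)]
    refine Finset.sum_congr rfl fun ξ _ => ?_
    simp [← map_star, act_inv_act]

instance : Algebra ℂ (CrossedProduct α) where
  toSMul := instSMul
  algebraMap :=
    { toFun := fun c => c • 1
      map_one' := by ext η; simp
      map_mul' := fun c d => by
        ext η
        rw [mul_apply, Finset.sum_eq_single 1]
        · simp [one_apply, mul_smul, smul_comm c d]
        · intro χ _ h; simp [one_apply, h]
        · simp
      map_zero' := by ext η; simp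
      map_add' := fun c d => by ext η; simp [add_smul] }
  commutes' c x := by
    change (c • (1 : CrossedProduct α)) * x = x * (c • 1)
    have h1 : (c • (1 : CrossedProduct α)) * x = c • (1 * x) := by
      ext η; simp only [mul_apply, smul_apply, Finset.smul_sum, smul_mul_assoc]
    have h2 : x * (c • (1 : CrossedProduct α)) = c • (x * 1) := by
      ext η; simp only [mul_apply, smul_apply, Finset.smul_sum, map_smul, mul_smul_comm]
    rw [h1, h2, one_mul, mul_one]
  smul_def' c x := by
    change c • x = (c • (1 : CrossedProduct α)) * x
    have h1 : (c • (1 : CrossedProduct α)) * x = c • (1 * x) := by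
      ext η; simp only [mul_apply, smul_apply, Finset.smul_sum, smul_mul_assoc]
    rw [h1, one_mul]

instance [StarModule ℂ B] : StarModule ℂ (CrossedProduct α) where
  star_smul c x := by ext η; simp [star_apply]

/-- The functional `ψ_⋊ (∑ b_χ u_χ) = n ψ(b_1)`, where `n` is the order of the group. -/
def functional (α : Γ →* (B ≃⋆ₐ[ℂ] B)) (ψ : B →ₗ[ℂ] ℂ) : CrossedProduct α →ₗ[ℂ] ℂ where
  toFun x := (Fintype.card Γ : ℂ) * ψ (x 1)
  map_add' x y := by simp [mul_add]
  map_smul' c x := by simp [mul_left_comm]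

/-- The map `E_⋊ (∑ b_χ u_χ) = n b_1`, where `n` is the order of the group. -/
def condExp (α : Γ →* (B ≃⋆ₐ[ℂ] B)) : CrossedProduct α →ₗ[ℂ] B where
  toFun x := (Fintype.card Γ : ℂ) • x 1
  map_add' x y := by simp
  map_smul' c x := smul_comm _ _ _

end CrossedProduct

/-! ### Voltage quantum graphs and derived quantum graphs

The finite abelian group `G` is written additively, its dual multiplicatively. -/

section Derived

/-- The dual of a finite abelian group (its characters with values in `ℂ`). -/
abbrev DualGroup (G : Type*) [AddCommGroup G] : Type _ := AddChar G ℂ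

instance instFintypeDual {G : Type*} [AddCommGroup G] [Finite G] : Fintype (DualGroup G) :=
  AddChar.instFintype G ℂ

variable {B G : Type*} [Ring B] [StarRing B] [Algebra ℂ B] [StarModule ℂ B]
  [AddCommGroup G] [Fintype G]

/-- `A = (A_g)` is a voltage quantum graph on `(B, ψ)` with respect to the action `α` of the dual
group on `(B, ψ)`. -/
structure IsVoltageQuantumGraph (ψ : B →ₗ[ℂ] ℂ) (α : DualGroup G →* (B ≃⋆ₐ[ℂ] B))
    (A : G → B →ₗ[ℂ] B) : Prop where
  isQuantumSet : IsQuantumSet ψ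
  functional_act : ∀ χ b, ψ (α χ b) = ψ b
  isQuantumGraph : ∀ g, IsQuantumGraph ψ (A g)
  commute_act : ∀ g χ b, A g (α χ b) = α χ (A g b)

/-- The map `X_g = (1/n) ∑ χ, conj(χ(g)) u_χ u_χ^†` on the crossed product, where
`u_χ^† b = ⟨u_χ, b⟩`. -/
def xMap (ψ : B →ₗ[ℂ] ℂ) (α : DualGroup G →* (B ≃⋆ₐ[ℂ] B)) (g : G) :
    CrossedProduct α →ₗ[ℂ] CrossedProduct α where
  toFun b := (Fintype.card G : ℂ)⁻¹ • ∑ χ : DualGroup G,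
    (star (χ g) * gnsInner (CrossedProduct.functional α ψ) (CrossedProduct.u χ) b) •
      (CrossedProduct.u χ : CrossedProduct α)
  map_add' b c := by
    simp only [gnsInner, mul_add, map_add, add_smul, Finset.sum_add_distrib, smul_add]
  map_smul' c b := by
    simp only [gnsInner, mul_smul_comm, map_smul, smul_eq_mul, RingHom.id_apply, Finset.smul_sum,
      smul_smul]
    exact Finset.sum_congr rfl fun χ _ => by congr 1; ring

/-- The derived quantum graph `∑ g, m (X_g ⊗ E* A_g E) m*` on the crossed product quantum set. -/
def derivedQuantumGraph (ψ : B →ₗ[ℂ] ℂ) (α : DualGroup G →* (B ≃⋆ₐ[ℂ] B))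
    (A : G → B →ₗ[ℂ] B) : CrossedProduct α →ₗ[ℂ] CrossedProduct α :=
  ∑ g, schurMul (CrossedProduct.functional α ψ) (xMap ψ α g)
    (gnsAdjoint (CrossedProduct.functional α ψ) ψ (CrossedProduct.condExp α) ∘ₗ A g ∘ₗ
      CrossedProduct.condExp α)

end Derived

/-! ### Classical objects -/

/-- The functional `ψ_V(f) = ∑ v, f v` on `ℂ^V`. -/
def classicalFunctional (V : Type*) [Fintype V] : (V → ℂ) →ₗ[ℂ] ℂ :=
  ∑ v, LinearMap.proj v

open Classical in
/-- The adjacency matrix on `ℂ^V` of the directed graph on `V` with an edge `v → w` iff `r v w`;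
it maps `e_v` to `∑ w with r v w, e_w`. -/
def adjacencyMap {V : Type*} [Fintype V] (r : V → V → Prop) : (V → ℂ) →ₗ[ℂ] (V → ℂ) :=
  Matrix.toLin' (Matrix.of fun w v => if r v w then (1 : ℂ) else 0)

/-- A voltage graph on the vertex set `V`: a finite directed graph (loops and multiple edges
allowed) with edges labelled by elements of `G`. -/
structure VoltageGraph (V G : Type*) where
  /-- the edges -/
  E : Type
  finite_edges : Finite E
  /-- starting vertex -/
  s : E → V
  /-- terminal vertex -/
  t : E → V
  /-- the labelling -/
  label : E → G

namespace VoltageGraph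

variable {V G : Type*}

/-- For any vertices `u, v` and any label `g` there is at most one edge `u → v` labelled `g`. -/
def PreSimple (Γ : VoltageGraph V G) : Prop :=
  ∀ e f : Γ.E, Γ.s e = Γ.s f → Γ.t e = Γ.t f → Γ.label e = Γ.label f → e = f

/-- The adjacency matrix of the subgraph of all edges labelled by `g`. -/
def adjacency [Fintype V] (Γ : VoltageGraph V G) (g : G) : (V → ℂ) →ₗ[ℂ] (V → ℂ) :=
  adjacencyMap fun v w => ∃ e : Γ.E, Γ.s e = v ∧ Γ.t e = w ∧ Γ.label e = g

end VoltageGraph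

/-- The action of a group on `ℂ^V` induced by an action on the set `V`: `e_v ↦ e_{σ_χ(v)}`. -/
def permAction {V Γ : Type*} [Group Γ] (σ : Γ →* Equiv.Perm V) :
    Γ →* ((V → ℂ) ≃⋆ₐ[ℂ] (V → ℂ)) where
  toFun χ :=
    { toFun := fun f v => f ((σ χ)⁻¹ v)
      invFun := fun f v => f (σ χ v)
      left_inv := fun f => by ext v; simp
      right_inv := fun f => by ext v; simp
      map_mul' := fun f g => rfl
      map_add' := fun f g => rfl
      map_star' := fun f => rfl
      map_smul' := fun c f => rfl }
  map_one' := by ext f v; simp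
  map_mul' χ ξ := by ext f v; simp

/-- The action of the dual of `ℤ/2` on two points in which the nontrivial character swaps them. -/
def swapHom : DualGroup (ZMod 2) →* Equiv.Perm (Fin 2) where
  toFun χ := if χ = 1 then 1 else Equiv.swap 0 1
  map_one' := by simp
  map_mul' χ ξ := by
    have key : ∀ η : DualGroup (ZMod 2), η ≠ 1 → η 1 = -1 := by
      intro η hη
      have h2 : η 1 * η 1 = 1 := by
        rw [← AddChar.map_add_eq_mul, show (1 + 1 : ZMod 2) = 0 by decide,
          AddChar.map_zero_eq_one]
      rcases mul_self_eq_one_iff.mp h2 with h | h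
      · refine absurd (DFunLike.ext _ _ fun a => ?_) hη
        fin_cases a
        · exact η.map_zero_eq_one
        · exact h
      · exact h
    by_cases h1 : χ = 1
    · simp [h1]
    by_cases h2 : ξ = 1
    · simp [h2]
    have h3 : χ * ξ = 1 := by
      refine DFunLike.ext _ _ fun a => ?_
      fin_cases a
      · exact (χ * ξ).map_zero_eq_one
      · change χ 1 * ξ 1 = 1
        rw [key χ h1, key ξ h2]; norm_num
    simp [h1, h2, h3]

/-- The action of the dual of `ℤ/2` on `ℂ²` that swaps the coordinates. -/
def swapAction : DualGroup (ZMod 2) →* ((Fin 2 → ℂ) ≃⋆ₐ[ℂ] (Fin 2 → ℂ)) := permAction swapHom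

/-- The functional `2 Tr` on the algebra of complex `2 × 2` matrices. -/
def twoTrace : Matrix (Fin 2) (Fin 2) ℂ →ₗ[ℂ] ℂ := (2 : ℂ) • Matrix.traceLinearMap (Fin 2) ℂ ℂ

end

/-!
The normalised Choi matrix turns the Schur product of linear maps on `M_n` into the product of
matrices. With the Pauli matrices as Kraus operators, an undirected loopfree quantum graph on `M_2`
therefore reads `x ↦ ∑ Q a b • σ_a x σ_b` for a real symmetric projection `Q` of size three: the
vanishing trace of the Kraus operators expresses looplessness, and selfadjointness makes `Q` real.
Such a `Q` is determined by a unit vector `v` and two switches, one for the line `ℝ v` and one for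
its orthogonal complement. The matrix `∑ v_a σ_a` is unitarily conjugate to `σ_z`, so the quantum
graph is isomorphic to `axisGraph σ_z p q`.

The regular permutation action identifies `M_2` with the crossed product of `ℂ²` by the dual of
`ℤ/2`. There `x ↦ σ_z x σ_z` changes the sign of the off-diagonal part, which comes from loops with
label `1` at both vertices, and the complementary part comes from the edges of both labels between
the two vertices.

The matrices `1`, `σ_z`, `σ_x`, `σ_x σ_z` form a nice error basis indexed by `(ℤ/2)²`, in which
`axisGraph σ_z p q` is the sum of the conjugations by the elements of a subset `S`. Conjugating by
the error basis, in one direction, and expanding along the projections onto its vectorisations, in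
the other, gives quantum isomorphisms with the Cayley graph of `S`.
-/

noncomputable section

/-! ### Dual frames and transport of structure -/

section DualFrames

variable {B B₁ B₂ ι : Type*}
  [Ring B] [StarRing B] [Algebra ℂ B] [Ring B₁] [StarRing B₁] [Algebra ℂ B₁]
  [Ring B₂] [StarRing B₂] [Algebra ℂ B₂]

theorem star_gnsInner {ψ : B →ₗ[ℂ] ℂ} (hψ : ∀ b, ψ (star b) = star (ψ b)) (x y : B) :
    star (gnsInner ψ x y) = gnsInner ψ y x := by
  rw [gnsInner, gnsInner, ← hψ, star_mul, star_star]

theorem gnsInner_smul_right (ψ : B →ₗ[ℂ] ℂ) (c : ℂ) (x y : B) :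
    gnsInner ψ x (c • y) = c * gnsInner ψ x y := by
  rw [gnsInner, mul_smul_comm, map_smul, smul_eq_mul, gnsInner]

theorem gnsInner_sum_right (ψ : B →ₗ[ℂ] ℂ) (s : Finset ι) (x : B) (y : ι → B) :
    gnsInner ψ x (∑ i ∈ s, y i) = ∑ i ∈ s, gnsInner ψ x (y i) := by
  simp only [gnsInner, Finset.mul_sum, map_sum]

theorem gnsInner_map {ψ₁ : B₁ →ₗ[ℂ] ℂ} {ψ₂ : B₂ →ₗ[ℂ] ℂ} {φ : B₁ ≃⋆ₐ[ℂ] B₂}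
    (hφ : ∀ b, ψ₂ (φ b) = ψ₁ b) (x y : B₁) : gnsInner ψ₂ (φ x) (φ y) = gnsInner ψ₁ x y := by
  rw [gnsInner, ← map_star, ← map_mul, hφ, gnsInner]

theorem gnsInner_tensorFunctional_tmul [StarModule ℂ B] (ψ : B →ₗ[ℂ] ℂ) (x y z w : B) :
    gnsInner (tensorFunctional ψ) (x ⊗ₜ y) (z ⊗ₜ w) = gnsInner ψ x z * gnsInner ψ y w := by
  simp only [gnsInner, tensorFunctional, TensorProduct.star_tmul,
    Algebra.TensorProduct.tmul_mul_tmul, LinearMap.comp_apply, TensorProduct.map_tmul,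
    LinearMap.mul'_apply]

variable [Fintype ι]

/-- Finite families `b` and `b'` in `B` such that `y = ∑ i, ⟨b i, y⟩_ψ • b' i` for all `y`, for
instance an orthonormal basis and itself. They make adjoints, and thus `m*`, explicit. -/
def IsDualFrame (ψ : B →ₗ[ℂ] ℂ) (b b' : ι → B) : Prop :=
  ∀ y, ∑ i, gnsInner ψ (b i) y • b' i = y

namespace IsDualFrame

theorem ext_right {ψ : B →ₗ[ℂ] ℂ} {b b' : ι → B} (hb : IsDualFrame ψ b b') {y z : B}
    (h : ∀ x, gnsInner ψ x y = gnsInner ψ x z) : y = z := by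
  rw [← hb y, ← hb z]
  simp only [h]

theorem map {ψ₁ : B₁ →ₗ[ℂ] ℂ} {ψ₂ : B₂ →ₗ[ℂ] ℂ} {b b' : ι → B₁} (hb : IsDualFrame ψ₁ b b')
    {φ : B₁ ≃⋆ₐ[ℂ] B₂} (hφ : ∀ b, ψ₂ (φ b) = ψ₁ b) : IsDualFrame ψ₂ (φ ∘ b) (φ ∘ b') := fun y => by
  obtain ⟨y, rfl⟩ := EquivLike.surjective φ y
  conv_rhs => rw [← hb y]
  simp only [Function.comp_apply, gnsInner_map hφ, map_sum, map_smul]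

theorem gnsAdjoint_eq {ψ₁ : B₁ →ₗ[ℂ] ℂ} {ψ₂ : B₂ →ₗ[ℂ] ℂ} {b b' : ι → B₁}
    (hb : IsDualFrame ψ₁ b b') {T : B₁ →ₗ[ℂ] B₂} {S : B₂ →ₗ[ℂ] B₁}
    (h : IsGNSAdjoint ψ₁ ψ₂ T S) : gnsAdjoint ψ₁ ψ₂ T = S := by
  have hex : ∃ S, IsGNSAdjoint ψ₁ ψ₂ T S := ⟨S, h⟩
  rw [gnsAdjoint, dif_pos hex]
  exact LinearMap.ext fun y => hb.ext_right fun x => by rw [← hex.choose_spec x y, h x y]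

theorem isGNSAdjoint_gnsAdjoint {ψ₁ : B₁ →ₗ[ℂ] ℂ} {ψ₂ : B₂ →ₗ[ℂ] ℂ}
    {b b' : ι → B₁} (hb : IsDualFrame ψ₁ b b') (hψ₁ : ∀ b, ψ₁ (star b) = star (ψ₁ b))
    (hψ₂ : ∀ b, ψ₂ (star b) = star (ψ₂ b)) (T : B₁ →ₗ[ℂ] B₂) :
    IsGNSAdjoint ψ₁ ψ₂ T (gnsAdjoint ψ₁ ψ₂ T) := by
  let S : B₂ →ₗ[ℂ] B₁ :=
    ∑ i, (ψ₂ ∘ₗ LinearMap.mulLeft ℂ (star (T (b' i)))).smulRight (b i)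
  have hS : IsGNSAdjoint ψ₁ ψ₂ T S := fun x y => by
    calc gnsInner ψ₂ (T x) y = star (gnsInner ψ₂ y (T (∑ i, gnsInner ψ₁ (b i) x • b' i))) := by
          rw [hb x, star_gnsInner hψ₂]
      _ = gnsInner ψ₁ x (∑ i, gnsInner ψ₂ (T (b' i)) y • b i) := by
          simp only [map_sum, map_smul, gnsInner_sum_right, gnsInner_smul_right, star_sum, star_mul,
            star_gnsInner hψ₁, star_gnsInner hψ₂]
      _ = gnsInner ψ₁ x (S y) := by
          simp only [S, LinearMap.sum_apply]; rfl
  rw [hb.gnsAdjoint_eq hS]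
  exact hS

variable [StarModule ℂ B] {ψ : B →ₗ[ℂ] ℂ} {b b' : ι → B}

theorem tensor (hb : IsDualFrame ψ b b') :
    IsDualFrame (tensorFunctional ψ) (fun p : ι × ι => b p.1 ⊗ₜ[ℂ] b p.2)
      fun p => b' p.1 ⊗ₜ b' p.2 := fun w => by
  induction w with
  | zero => simp only [gnsInner, mul_zero, map_zero, zero_smul, Finset.sum_const_zero]
  | add w₁ w₂ h₁ h₂ =>
    conv_rhs => rw [← h₁, ← h₂]
    simp only [gnsInner, mul_add, map_add, add_smul, Finset.sum_add_distrib]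
  | tmul y z =>
    conv_rhs => rw [← hb y, ← hb z]
    simp only [gnsInner_tensorFunctional_tmul, Fintype.sum_prod_type, TensorProduct.sum_tmul,
      TensorProduct.tmul_sum, TensorProduct.smul_tmul_smul]
    exact Finset.sum_comm

theorem comulMap_apply (hb : IsDualFrame ψ b b') (hψ : ∀ b, ψ (star b) = star (ψ b)) (x : B) :
    comulMap ψ x = ∑ i, b i ⊗ₜ (star (b' i) * x) := by
  let S : B →ₗ[ℂ] B ⊗[ℂ] B :=
    ∑ i, TensorProduct.mk ℂ B B (b i) ∘ₗ LinearMap.mulLeft ℂ (star (b' i))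
  have hS : IsGNSAdjoint (tensorFunctional ψ) ψ (LinearMap.mul' ℂ B) S := fun w x => by
    induction w with
    | zero => simp only [gnsInner, map_zero, star_zero, zero_mul]
    | add w₁ w₂ h₁ h₂ =>
      simp only [gnsInner, map_add, star_add, add_mul] at h₁ h₂ ⊢
      rw [h₁, h₂]
    | tmul y z =>
      calc gnsInner ψ (y * z) x = ψ (star z * (star y * x)) := by
            rw [gnsInner, star_mul, mul_assoc]
        _ = ψ (star z * (star (∑ i, gnsInner ψ (b i) y • b' i) * x)) := by rw [hb y]
        _ = ∑ i, gnsInner ψ y (b i) * gnsInner ψ z (star (b' i) * x) := by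
            simp only [star_sum, star_smul, star_gnsInner hψ, Finset.sum_mul, Finset.mul_sum,
              smul_mul_assoc, mul_smul_comm, map_sum, map_smul, smul_eq_mul]
            rfl
        _ = gnsInner (tensorFunctional ψ) (y ⊗ₜ z) (S x) := by
            simp only [S, LinearMap.sum_apply, gnsInner_sum_right, LinearMap.comp_apply,
              TensorProduct.mk_apply, LinearMap.mulLeft_apply, gnsInner_tensorFunctional_tmul]
  rw [comulMap, hb.tensor.gnsAdjoint_eq hS]
  simp only [S, LinearMap.sum_apply]; rfl

theorem schurMul_apply (hb : IsDualFrame ψ b b') (hψ : ∀ b, ψ (star b) = star (ψ b))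
    (S T : B →ₗ[ℂ] B) (x : B) : schurMul ψ S T x = ∑ i, S (b i) * T (star (b' i) * x) := by
  simp only [schurMul, LinearMap.comp_apply, hb.comulMap_apply hψ, map_sum, TensorProduct.map_tmul,
    LinearMap.mul'_apply]

theorem schurMul_sum_rankOne_apply {κ : Type*} [Fintype κ] (hb : IsDualFrame ψ b b')
    (hψ : ∀ b, ψ (star b) = star (ψ b)) {S : B →ₗ[ℂ] B} {a c : κ → B}
    (hS : ∀ y, S y = ∑ k, gnsInner ψ (a k) y • c k) (T : B →ₗ[ℂ] B) (x : B) :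
    schurMul ψ S T x = ∑ k, c k * T (star (a k) * x) := by
  have hstar (k : κ) : star (a k) = ∑ i, gnsInner ψ (a k) (b i) • star (b' i) := by
    conv_lhs => rw [← hb (a k)]
    simp only [star_sum, star_smul, star_gnsInner hψ]
  simp only [hb.schurMul_apply hψ, hS, hstar, Finset.sum_mul, smul_mul_assoc, map_sum, map_smul,
    Finset.mul_sum, mul_smul_comm]
  exact Finset.sum_comm

end IsDualFrame

theorem schurMul_id_id (ψ : B →ₗ[ℂ] ℂ) [StarModule ℂ B] :
    schurMul ψ LinearMap.id LinearMap.id = LinearMap.mul' ℂ B ∘ₗ comulMap ψ := by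
  rw [schurMul, TensorProduct.map_id, LinearMap.id_comp]

section Transport

variable [StarModule ℂ B₁] [StarModule ℂ B₂] {ψ₁ : B₁ →ₗ[ℂ] ℂ} {ψ₂ : B₂ →ₗ[ℂ] ℂ}
  {b b' : ι → B₁} {φ : B₁ ≃⋆ₐ[ℂ] B₂}

theorem IsDualFrame.map_schurMul (hb : IsDualFrame ψ₁ b b')
    (hψ₁ : ∀ b, ψ₁ (star b) = star (ψ₁ b)) (hφ : ∀ b, ψ₂ (φ b) = ψ₁ b)
    {S T : B₁ →ₗ[ℂ] B₁} {S' T' : B₂ →ₗ[ℂ] B₂}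
    (hS : ∀ x, φ (S x) = S' (φ x)) (hT : ∀ x, φ (T x) = T' (φ x)) (x : B₁) :
    φ (schurMul ψ₁ S T x) = schurMul ψ₂ S' T' (φ x) := by
  have hψ₂ (y : B₂) : ψ₂ (star y) = star (ψ₂ y) := by
    obtain ⟨y, rfl⟩ := EquivLike.surjective φ y
    rw [← map_star, hφ, hφ, hψ₁]
  simp only [hb.schurMul_apply hψ₁, (hb.map hφ).schurMul_apply hψ₂, map_sum, map_mul, hS, hT,
    Function.comp_apply, map_star]

theorem IsQuantumSet.map (h : IsQuantumSet ψ₁) (hb : IsDualFrame ψ₁ b b')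
    (hψ₁ : ∀ b, ψ₁ (star b) = star (ψ₁ b)) (hφ : ∀ b, ψ₂ (φ b) = ψ₁ b) : IsQuantumSet ψ₂ := by
  have hinner (y : B₁) : ψ₂ (star (φ y) * φ y) = ψ₁ (star y * y) := gnsInner_map hφ y y
  have hsurj := EquivLike.surjective φ
  refine ⟨?_, hsurj.forall.2 fun y => ?_, hsurj.forall.2 fun y hy => ?_, ?_⟩
  · have := h.finiteDimensional
    exact Module.Finite.of_surjective (φ : B₁ →ₗ[ℂ] B₂) hsurj
  · rw [hinner]
    exact h.nonneg y
  · rw [h.faithful y ((hinner y).symm.trans hy), map_zero]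
  · refine LinearMap.ext (hsurj.forall.2 fun y => ?_)
    have hid (x : B₁) : φ (LinearMap.id (R := ℂ) x) = LinearMap.id (R := ℂ) (φ x) := rfl
    rw [← schurMul_id_id, ← hb.map_schurMul hψ₁ hφ hid hid, schurMul_id_id,
      h.mul_comul, LinearMap.id_apply, LinearMap.id_apply]

theorem IsQuantumGraph.map {A₁ : B₁ →ₗ[ℂ] B₁} {A₂ : B₂ →ₗ[ℂ] B₂} (h : IsQuantumGraph ψ₁ A₁)
    (hb : IsDualFrame ψ₁ b b') (hψ₁ : ∀ b, ψ₁ (star b) = star (ψ₁ b)) (hφ : ∀ b, ψ₂ (φ b) = ψ₁ b)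
    (hA : ∀ x, φ (A₁ x) = A₂ (φ x)) : IsQuantumGraph ψ₂ A₂ where
  schur_idempotent := LinearMap.ext <| (EquivLike.surjective φ).forall.2 fun y => by
    rw [← hb.map_schurMul hψ₁ hφ hA hA, h.schur_idempotent, hA]
  map_star := (EquivLike.surjective φ).forall.2 fun y => by
    rw [← StarHomClass.map_star φ, ← hA, h.map_star, StarHomClass.map_star φ, hA]

end Transport

end DualFrames

section QuantumIsomorphisms

variable {B₁ B₂ B₃ : Type*}
  [Ring B₁] [StarRing B₁] [Algebra ℂ B₁] [Ring B₂] [StarRing B₂] [Algebra ℂ B₂]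
  [Ring B₃] [StarRing B₃] [Algebra ℂ B₃]
  {ψ₁ : B₁ →ₗ[ℂ] ℂ} {ψ₂ : B₂ →ₗ[ℂ] ℂ} {ψ₃ : B₃ →ₗ[ℂ] ℂ}
  {A₁ : B₁ →ₗ[ℂ] B₁} {A₂ : B₂ →ₗ[ℂ] B₂} {A₃ : B₃ →ₗ[ℂ] B₃}

theorem ampInner_ampMap {d : ℕ} (ρ : B₁ →⋆ₐ[ℂ] Matrix (Fin d) (Fin d) B₂) (x y : Fin d → B₁) :
    ampInner ψ₂ (ampMap ρ x) (ampMap ρ y) = ∑ j, ∑ k, ψ₂ (ρ (star (x j) * y k) j k) := by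
  have hentry (j k) : ρ (star (x j) * y k) j k = ∑ i, star (ρ (x j) i j) * ρ (y k) i k := by
    simp only [map_mul, map_star, Matrix.mul_apply, Matrix.star_apply]
  simp only [ampInner, ampMap, gnsInner, hentry, star_sum, Finset.sum_mul_sum, map_sum]
  rw [Finset.sum_comm]
  exact Finset.sum_congr rfl fun j _ => Finset.sum_comm

theorem IsQuantumIso.of_functional_map {ι : Type*} [Fintype ι] {b b' : ι → B₁}
    (hb : IsDualFrame ψ₁ b b') [FiniteDimensional ℂ B₁] [FiniteDimensional ℂ B₂]
    (hfin : Module.finrank ℂ B₁ = Module.finrank ℂ B₂) {d : ℕ}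
    {ρ : B₁ →⋆ₐ[ℂ] Matrix (Fin d) (Fin d) B₂}
    (hρ : ∀ a j k, ψ₂ (ρ a j k) = if j = k then ψ₁ a else 0) : IsQuantumIso ψ₁ ψ₂ ρ := by
  let p : (Fin d → B₁) →ₗ[ℂ] Fin d → B₂ :=
    { toFun := ampMap ρ
      map_add' := fun x y => by
        ext i
        simp only [ampMap, Pi.add_apply, map_add, Matrix.add_apply, Finset.sum_add_distrib]
      map_smul' := fun c x => by
        ext i
        simp only [ampMap, Pi.smul_apply, map_smul, Matrix.smul_apply, RingHom.id_apply,
          Finset.smul_sum] }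
  have hisometry (x y : Fin d → B₁) : ampInner ψ₂ (p x) (p y) = ampInner ψ₁ x y := by
    refine (ampInner_ampMap ρ x y).trans ?_
    simp only [hρ, Finset.sum_ite_eq, Finset.mem_univ, if_true, ampInner, gnsInner]
  have hinner (i : Fin d) (a : B₁) (x : Fin d → B₁) :
      ampInner ψ₁ (Pi.single i a) x = gnsInner ψ₁ a (x i) := by
    rw [ampInner, Finset.sum_eq_single i, Pi.single_eq_same]
    · intro j _ hj
      rw [Pi.single_eq_of_ne hj, gnsInner, star_zero, zero_mul, map_zero]
    · exact fun h => absurd (Finset.mem_univ i) h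
  have hinj : Function.Injective p := (injective_iff_map_eq_zero p).2 fun x hx => by
    ext i
    refine hb.ext_right fun a => ?_
    rw [← hinner, ← hisometry, hx]
    simp only [ampInner, gnsInner, Pi.zero_apply, mul_zero, map_zero, Finset.sum_const_zero]
  have hdim : Module.finrank ℂ (Fin d → B₁) = Module.finrank ℂ (Fin d → B₂) := by
    simp only [Module.finrank_pi_fintype, hfin]
  exact ⟨⟨hinj, (LinearMap.injective_iff_surjective_of_finrank_eq_finrank hdim).1 hinj⟩, hisometry⟩

theorem QuantumGraphIsomorphic.symm (h : QuantumGraphIsomorphic ψ₁ A₁ ψ₂ A₂) :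
    QuantumGraphIsomorphic ψ₂ A₂ ψ₁ A₁ := by
  obtain ⟨φ, hφ, hA⟩ := h
  refine ⟨φ.symm, fun b => ?_, fun b => EquivLike.injective φ ?_⟩
  · rw [← hφ, φ.apply_symm_apply]
  · rw [hA, φ.apply_symm_apply, φ.apply_symm_apply]

theorem QuantumGraphIsomorphic.trans (h₁₂ : QuantumGraphIsomorphic ψ₁ A₁ ψ₂ A₂)
    (h₂₃ : QuantumGraphIsomorphic ψ₂ A₂ ψ₃ A₃) : QuantumGraphIsomorphic ψ₁ A₁ ψ₃ A₃ := by
  obtain ⟨φ, hφ, hA₁₂⟩ := h₁₂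
  obtain ⟨θ, hθ, hA₂₃⟩ := h₂₃
  refine ⟨φ.trans θ, fun b => ?_, fun b => ?_⟩
  · exact (hθ (φ b)).trans (hφ b)
  · exact (congrArg θ (hA₁₂ b)).trans (hA₂₃ (φ b))

theorem QuantumGraphIsomorphic.trans_quantumIsomorphic (h₁₂ : QuantumGraphIsomorphic ψ₁ A₁ ψ₂ A₂)
    (h₂₃ : QuantumGraphQuantumIsomorphic ψ₂ A₂ ψ₃ A₃) :
    QuantumGraphQuantumIsomorphic ψ₁ A₁ ψ₃ A₃ := by
  obtain ⟨φ, hφ, hA₁₂⟩ := h₁₂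
  obtain ⟨d, ρ, hd, hρ, hA₂₃⟩ := h₂₃
  have hamp (x : Fin d → B₁) :
      ampMap (ρ.comp (φ : B₁ →⋆ₐ[ℂ] B₂)) x = ampMap ρ (φ ∘ x) := rfl
  refine ⟨d, ρ.comp (φ : B₁ →⋆ₐ[ℂ] B₂), hd, ⟨?_, fun x y => ?_⟩, fun b => ?_⟩
  · exact hρ.bijective.comp (Equiv.arrowCongr (Equiv.refl _) φ.toEquiv).bijective
  · rw [hamp, hamp, hρ.inner_map]
    simp only [ampInner, Function.comp_apply, gnsInner_map hφ]
  · exact (congrArg ρ (hA₁₂ b)).trans (hA₂₃ (φ b))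

theorem QuantumGraphQuantumIsomorphic.trans_isomorphic
    (h₁₂ : QuantumGraphQuantumIsomorphic ψ₁ A₁ ψ₂ A₂) (h₂₃ : QuantumGraphIsomorphic ψ₂ A₂ ψ₃ A₃) :
    QuantumGraphQuantumIsomorphic ψ₁ A₁ ψ₃ A₃ := by
  obtain ⟨d, ρ, hd, hρ, hA₁₂⟩ := h₁₂
  obtain ⟨φ, hφ, hA₂₃⟩ := h₂₃
  let Φ : Matrix (Fin d) (Fin d) B₂ →⋆ₐ[ℂ] Matrix (Fin d) (Fin d) B₃ :=
    { (φ : B₂ →ₐ[ℂ] B₃).mapMatrix with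
      map_star' := fun M => Matrix.ext fun i j => map_star φ (M j i) }
  have hamp (x : Fin d → B₁) : ampMap (Φ.comp ρ) x = φ ∘ ampMap ρ x :=
    funext fun i => (map_sum φ _ _).symm
  refine ⟨d, Φ.comp ρ, hd, ⟨?_, fun x y => ?_⟩, fun b => ?_⟩
  · rw [funext hamp]
    exact (Equiv.arrowCongr (Equiv.refl _) φ.toEquiv).bijective.comp hρ.bijective
  · rw [hamp, hamp, ← hρ.inner_map]
    simp only [ampInner, Function.comp_apply, gnsInner_map hφ]
  · ext i j
    exact (congrArg (fun M : Matrix _ _ B₂ => φ (M i j)) (hA₁₂ b)).trans (hA₂₃ (ρ b i j))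

end QuantumIsomorphisms

/-! ### Crossed products -/

namespace CrossedProduct

section Functional

variable {B Γ ι : Type*} [Ring B] [StarRing B] [Algebra ℂ B] [Group Γ]
  {α : Γ →* (B ≃⋆ₐ[ℂ] B)} {ψ : B →ₗ[ℂ] ℂ}

theorem single_apply_self (χ : Γ) (b : B) : (single χ b : CrossedProduct α) χ = b := by
  classical exact Pi.single_eq_same (M := fun _ => B) χ b

theorem single_apply_of_ne {χ η : Γ} (h : η ≠ χ) (b : B) :
    (single χ b : CrossedProduct α) η = 0 := by
  classical exact Pi.single_eq_of_ne (M := fun _ => B) h b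

theorem star_u (χ : Γ) : star (u χ : CrossedProduct α) = u χ⁻¹ := by
  ext η
  by_cases h : η = χ⁻¹
  · rw [h, star_apply, inv_inv, u, u, single_apply_self, single_apply_self, star_one, map_one]
  · rw [star_apply, u, u, single_apply_of_ne h, single_apply_of_ne (mt inv_eq_iff_eq_inv.1 h),
      star_zero, map_zero]

theorem sum_apply {κ : Type*} (s : Finset κ) (x : κ → CrossedProduct α) (χ : Γ) :
    (∑ k ∈ s, x k) χ = ∑ k ∈ s, x k χ :=
  Finset.sum_apply χ s x

variable [Fintype Γ]

theorem u_mul_apply (χ : Γ) (x : CrossedProduct α) (η : Γ) :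
    (u χ * x : CrossedProduct α) η = α χ (x (χ⁻¹ * η)) := by
  rw [mul_apply, Finset.sum_eq_single χ _ (by simp)]
  · rw [u, single_apply_self, one_mul]
  · intro ξ _ hξ
    rw [u, single_apply_of_ne hξ, zero_mul]

theorem functional_apply (x : CrossedProduct α) :
    functional α ψ x = Fintype.card Γ * ψ (x 1) := rfl

theorem condExp_apply (x : CrossedProduct α) :
    condExp α x = (Fintype.card Γ : ℂ) • x 1 := rfl

theorem functional_star (hψ : ∀ b, ψ (star b) = star (ψ b)) (x : CrossedProduct α) :
    functional α ψ (star x) = star (functional α ψ x) := by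
  rw [functional_apply, functional_apply, star_apply, inv_one, map_one_act, hψ, star_mul',
    star_natCast]

theorem gnsInner_functional (hα : ∀ χ b, ψ (α χ b) = ψ b) (x y : CrossedProduct α) :
    gnsInner (functional α ψ) x y = Fintype.card Γ * ∑ χ, gnsInner ψ (x χ) (y χ) := by
  simp only [gnsInner, functional_apply, mul_apply, star_apply, mul_one, ← map_mul, map_sum, hα]
  exact congrArg _ (Equiv.sum_comp (Equiv.inv Γ) fun χ => gnsInner ψ (x χ) (y χ))

theorem gnsInner_functional_single (hα : ∀ χ b, ψ (α χ b) = ψ b) (χ : Γ) (b : B)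
    (y : CrossedProduct α) :
    gnsInner (functional α ψ) (single χ b) y = Fintype.card Γ * gnsInner ψ b (y χ) := by
  rw [gnsInner_functional hα, Finset.sum_eq_single χ _ (by simp)]
  · rw [single_apply_self]
  · intro ξ _ hξ
    rw [single_apply_of_ne hξ, gnsInner, star_zero, zero_mul, map_zero]

variable [Fintype ι] {b b' : ι → B}

theorem isDualFrame_functional (hb : IsDualFrame ψ b b') (hα : ∀ χ b, ψ (α χ b) = ψ b) :
    IsDualFrame (functional α ψ) (fun p : Γ × ι => single p.1 (b p.2))
      fun p => (Fintype.card Γ : ℂ)⁻¹ • single p.1 (b' p.2) := fun y => by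
  have hn : (Fintype.card Γ : ℂ) ≠ 0 := Nat.cast_ne_zero.2 Fintype.card_ne_zero
  ext χ
  simp only [gnsInner_functional_single hα, smul_smul, mul_right_comm _ _ (Fintype.card Γ : ℂ)⁻¹,
    mul_inv_cancel₀ hn, one_mul, Fintype.sum_prod_type, sum_apply, smul_apply]
  rw [Finset.sum_eq_single χ _ (by simp)]
  · simp only [single_apply_self]
    exact hb (y χ)
  · intro ξ _ hξ
    simp only [single_apply_of_ne hξ.symm, smul_zero, Finset.sum_const_zero]

theorem gnsAdjoint_condExp_apply (hb : IsDualFrame ψ b b')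
    (hψ : ∀ b, ψ (star b) = star (ψ b)) (hα : ∀ χ b, ψ (α χ b) = ψ b) (c : B) :
    gnsAdjoint (functional α ψ) ψ (condExp α) c = single 1 c := by
  classical
  let incl : B →ₗ[ℂ] CrossedProduct α :=
    { toFun := single 1
      map_add' := Pi.single_add (f := fun _ => B) 1
      map_smul' := Pi.single_smul (f := fun _ => B) 1 }
  have hadj : IsGNSAdjoint (functional α ψ) ψ (condExp α) incl := fun x y => by
    calc gnsInner ψ (condExp α x) y = star (gnsInner ψ y ((Fintype.card Γ : ℂ) • x 1)) :=
          (star_gnsInner hψ _ _).symm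
      _ = star (gnsInner (functional α ψ) (single 1 y) x) := by
          rw [gnsInner_functional_single hα, gnsInner_smul_right]
      _ = gnsInner (functional α ψ) x (incl y) := star_gnsInner (functional_star hψ) _ _
  rw [(isDualFrame_functional hb hα).gnsAdjoint_eq hadj]
  rfl

theorem u_mul_gnsAdjoint_condExp_apply (hb : IsDualFrame ψ b b')
    (hψ : ∀ b, ψ (star b) = star (ψ b)) (hα : ∀ χ b, ψ (α χ b) = ψ b)
    {T : B →ₗ[ℂ] B} (hT : ∀ χ b, T (α χ b) = α χ (T b)) (x : CrossedProduct α)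
    (χ : Γ) :
    u χ * (gnsAdjoint (functional α ψ) ψ (condExp α) ∘ₗ T ∘ₗ condExp α) (star (u χ) * x) =
      (Fintype.card Γ : ℂ) • single χ (T (x χ)) := by
  ext η
  have hE : condExp α (star (u χ) * x) = (Fintype.card Γ : ℂ) • α χ⁻¹ (x χ) := by
    rw [condExp_apply, star_u, u_mul_apply, inv_inv, mul_one]
  rw [LinearMap.comp_apply, LinearMap.comp_apply, hE, gnsAdjoint_condExp_apply hb hψ hα,
    u_mul_apply, smul_apply, map_smul, hT]
  by_cases h : η = χ
  · rw [h, inv_mul_cancel, single_apply_self, single_apply_self, map_smul, ← map_mul_act,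
      mul_inv_cancel, map_one_act]
  · rw [single_apply_of_ne h, single_apply_of_ne (mt inv_mul_eq_one.1 (Ne.symm h)), map_zero,
      smul_zero]

end Functional

end CrossedProduct

section Derived

open CrossedProduct

variable {B G : Type*} [Ring B] [StarRing B] [Algebra ℂ B] [AddCommGroup G] [Fintype G]
  {α : DualGroup G →* (B ≃⋆ₐ[ℂ] B)} {ψ : B →ₗ[ℂ] ℂ}

theorem xMap_apply (g : G) (x : CrossedProduct α) :
    xMap ψ α g x = (Fintype.card G : ℂ)⁻¹ • ∑ χ : DualGroup G,
      (star (χ g) * gnsInner (functional α ψ) (u χ) x) • (u χ : CrossedProduct α) := rfl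

theorem derivedQuantumGraph_apply {ι : Type*} [Fintype ι] [StarModule ℂ B] {A : G → B →ₗ[ℂ] B}
    {b b' : ι → B} (hb : IsDualFrame ψ b b') (hψ : ∀ b, ψ (star b) = star (ψ b))
    (hα : ∀ χ b, ψ (α χ b) = ψ b) (hA : ∀ g χ b, A g (α χ b) = α χ (A g b))
    (x : CrossedProduct α) (χ : DualGroup G) :
    derivedQuantumGraph ψ α A x χ = ∑ g, star (χ g) • A g (x χ) := by
  have hn : (Fintype.card G : ℂ) ≠ 0 := Nat.cast_ne_zero.2 Fintype.card_ne_zero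
  have hcard : Fintype.card (DualGroup G) = Fintype.card G := AddChar.card_eq
  have hX (g : G) (y : CrossedProduct α) : xMap ψ α g y = ∑ χ : DualGroup G,
      gnsInner (functional α ψ) (u χ) y •
        ((Fintype.card G : ℂ)⁻¹ * star (χ g)) • (u χ : CrossedProduct α) := by
    rw [xMap_apply, Finset.smul_sum]
    refine Finset.sum_congr rfl fun χ _ => ?_
    rw [smul_smul, smul_smul]
    ring_nf
  rw [derivedQuantumGraph, LinearMap.sum_apply, CrossedProduct.sum_apply]
  refine Finset.sum_congr rfl fun g _ => ?_
  rw [(isDualFrame_functional hb hα).schurMul_sum_rankOne_apply (functional_star hψ) (hX g)]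
  simp only [smul_mul_assoc, u_mul_gnsAdjoint_condExp_apply hb hψ hα (hA g), smul_smul, hcard,
    mul_right_comm _ _ (Fintype.card G : ℂ), inv_mul_cancel₀ hn, one_mul, CrossedProduct.sum_apply,
    CrossedProduct.smul_apply]
  rw [Finset.sum_eq_single χ _ (by simp), single_apply_self]
  intro ξ _ hξ
  rw [single_apply_of_ne hξ.symm, smul_zero]

end Derived

open Matrix

/-! ### Quantum graphs on matrix algebras -/

section MatrixAlgebra

variable {n ι : Type*} [Fintype n]

/-- The functional `n Tr` on `M_n`, the multiple of the trace for which `m m* = Id`. -/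
def matrixFunctional (n : Type*) [Fintype n] : Matrix n n ℂ →ₗ[ℂ] ℂ :=
  (Fintype.card n : ℂ) • traceLinearMap n ℂ ℂ

theorem matrixFunctional_apply (x : Matrix n n ℂ) :
    matrixFunctional n x = Fintype.card n * trace x := rfl

theorem twoTrace_eq_matrixFunctional : twoTrace = matrixFunctional (Fin 2) := by
  rw [twoTrace, matrixFunctional, Fintype.card_fin, Nat.cast_ofNat]

theorem matrixFunctional_star (x : Matrix n n ℂ) :
    matrixFunctional n (star x) = star (matrixFunctional n x) := by
  simp only [matrixFunctional_apply, star_eq_conjTranspose, trace_conjTranspose, star_mul',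
    star_natCast]

variable [DecidableEq n]

theorem gnsInner_matrixFunctional (x y : Matrix n n ℂ) :
    gnsInner (matrixFunctional n) x y = Fintype.card n * trace (xᴴ * y) := rfl

theorem gnsInner_matrixFunctional_single (i j : n) (x : Matrix n n ℂ) :
    gnsInner (matrixFunctional n) (single i j 1) x = Fintype.card n * x i j := by
  rw [gnsInner_matrixFunctional, conjTranspose_single, star_one, trace_single_mul, one_smul]

/-- The Choi matrix of a linear map on `M_n`, with rows and columns indexed by pairs and normalised
so that it turns the Schur product into the product of matrices. -/
def choiMatrix (A : Matrix n n ℂ →ₗ[ℂ] Matrix n n ℂ) : Matrix (n × n) (n × n) ℂ :=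
  of fun p q => (Fintype.card n : ℂ)⁻¹ * A (single p.1 q.1 1) p.2 q.2

theorem choiMatrix_apply (A : Matrix n n ℂ →ₗ[ℂ] Matrix n n ℂ) (p q : n × n) :
    choiMatrix A p q = (Fintype.card n : ℂ)⁻¹ * A (single p.1 q.1 1) p.2 q.2 := rfl

theorem isHermitian_choiMatrix {A : Matrix n n ℂ →ₗ[ℂ] Matrix n n ℂ}
    (hA : ∀ x, A (star x) = star (A x)) : (choiMatrix A).IsHermitian := by
  ext p q
  have h := congrFun₂ (hA (single q.1 p.1 1)) p.2 q.2
  rw [star_eq_conjTranspose, conjTranspose_single, star_one] at h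
  rw [conjTranspose_apply, choiMatrix_apply, choiMatrix_apply, h, star_mul', star_inv₀,
    star_natCast]
  rfl

/-- The matrix whose columns are the vectorised matrices `K a`. -/
def krausMatrix (K : ι → Matrix n n ℂ) : Matrix (n × n) ι ℂ := of fun p a => K a p.2 p.1

omit [Fintype n] [DecidableEq n] in
theorem krausMatrix_apply (K : ι → Matrix n n ℂ) (p : n × n) (a : ι) :
    krausMatrix K p a = K a p.2 p.1 := rfl

omit [Fintype n] [DecidableEq n] in
theorem star_krausMatrix_apply {K : ι → Matrix n n ℂ} (hK : ∀ a, (K a).IsHermitian)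
    (p : n × n) (a : ι) : star (krausMatrix K p a) = krausMatrix K p.swap a :=
  (hK a).apply p.1 p.2

theorem mul_single_mul_apply {K : ι → Matrix n n ℂ} (hK : ∀ a, (K a).IsHermitian)
    (p q : n × n) (a b : ι) :
    (K a * single p.1 q.1 (1 : ℂ) * K b) p.2 q.2 =
      krausMatrix K p a * star (krausMatrix K q b) := by
  rw [star_krausMatrix_apply hK, krausMatrix_apply, krausMatrix_apply, Matrix.mul_assoc,
    mul_apply, Finset.sum_eq_single p.1 _ (by simp), single_mul_apply_same, one_mul]
  · rfl
  · intro k _ hk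
    rw [single_mul_apply_of_ne _ _ _ _ _ hk, mul_zero]

theorem choiMatrix_eq_krausMatrix_mul [Fintype ι] {K : ι → Matrix n n ℂ}
    (hK : ∀ a, (K a).IsHermitian) {A : Matrix n n ℂ →ₗ[ℂ] Matrix n n ℂ} {Q : Matrix ι ι ℂ}
    (hA : ∀ x, A x = ∑ a, ∑ b, Q a b • (K a * x * K b)) :
    choiMatrix A = (Fintype.card n : ℂ)⁻¹ • (krausMatrix K * Q * (krausMatrix K)ᴴ) := by
  ext p q
  simp only [choiMatrix_apply, hA, Matrix.sum_apply, Matrix.smul_apply, mul_single_mul_apply hK,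
    smul_eq_mul]
  simp only [mul_apply, conjTranspose_apply, Finset.sum_mul]
  rw [Finset.sum_comm]
  exact congrArg _ (Finset.sum_congr rfl fun b _ => Finset.sum_congr rfl fun a _ => by ring)

variable [Nonempty n]

theorem isDualFrame_matrixFunctional :
    IsDualFrame (matrixFunctional n) (fun p : n × n => single p.1 p.2 1)
      fun p => (Fintype.card n : ℂ)⁻¹ • single p.1 p.2 1 := fun x => by
  have hn : (Fintype.card n : ℂ) ≠ 0 := Nat.cast_ne_zero.2 Fintype.card_ne_zero
  conv_rhs => rw [matrix_eq_sum_single x]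
  simp only [gnsInner_matrixFunctional_single, smul_single, smul_eq_mul, mul_one,
    mul_right_comm _ _ (Fintype.card n : ℂ)⁻¹, mul_inv_cancel₀ hn, one_mul, Fintype.sum_prod_type]

theorem schurMul_matrixFunctional_apply (S T : Matrix n n ℂ →ₗ[ℂ] Matrix n n ℂ)
    (x : Matrix n n ℂ) : schurMul (matrixFunctional n) S T x =
      (Fintype.card n : ℂ)⁻¹ • ∑ i, ∑ j, S (single i j 1) * T (single j i 1 * x) := by
  rw [isDualFrame_matrixFunctional.schurMul_apply matrixFunctional_star]
  simp only [star_smul, star_inv₀, star_natCast, star_eq_conjTranspose, conjTranspose_single,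
    star_one, smul_mul_assoc, map_smul, mul_smul_comm, ← Finset.smul_sum, Fintype.sum_prod_type]

open scoped ComplexOrder in
theorem isQuantumSet_matrixFunctional : IsQuantumSet (matrixFunctional n) where
  finiteDimensional := inferInstance
  nonneg x := by
    have h : 0 ≤ trace (xᴴ * x) := (posSemidef_conjTranspose_mul_self x).trace_nonneg
    have h' : 0 ≤ matrixFunctional n (star x * x) := mul_nonneg (Nat.cast_nonneg _) h
    exact ⟨(Complex.nonneg_iff.1 h').1, (Complex.nonneg_iff.1 h').2.symm⟩
  faithful x hx := by
    have hn : (Fintype.card n : ℂ) ≠ 0 := Nat.cast_ne_zero.2 Fintype.card_ne_zero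
    exact trace_conjTranspose_mul_self_eq_zero_iff.1 ((mul_eq_zero.1 hx).resolve_left hn)
  mul_comul := by
    have hn : (Fintype.card n : ℂ) ≠ 0 := Nat.cast_ne_zero.2 Fintype.card_ne_zero
    ext1 x
    rw [← schurMul_id_id, schurMul_matrixFunctional_apply]
    simp only [LinearMap.id_apply, ← Matrix.mul_assoc, single_mul_single_same, mul_one,
      Finset.sum_const, Finset.card_univ, ← Finset.smul_sum, ← Finset.sum_mul]
    rw [← Nat.cast_smul_eq_nsmul ℂ, smul_smul, inv_mul_cancel₀ hn, one_smul, sum_single_one,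
      Matrix.one_mul]

theorem choiMatrix_injective :
    Function.Injective (choiMatrix : (Matrix n n ℂ →ₗ[ℂ] Matrix n n ℂ) → _) := fun S T h => by
  have hn : (Fintype.card n : ℂ)⁻¹ ≠ 0 := inv_ne_zero (Nat.cast_ne_zero.2 Fintype.card_ne_zero)
  refine Matrix.ext_linearMap ℂ fun i j => LinearMap.ext_ring (Matrix.ext fun k l => ?_)
  exact mul_left_cancel₀ hn (congrFun₂ h (i, k) (j, l))

theorem choiMatrix_schurMul (S T : Matrix n n ℂ →ₗ[ℂ] Matrix n n ℂ) :
    choiMatrix (schurMul (matrixFunctional n) S T) = choiMatrix S * choiMatrix T := by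
  ext ⟨a, k⟩ ⟨b, l⟩
  have hschur : schurMul (matrixFunctional n) S T (single a b 1) =
      (Fintype.card n : ℂ)⁻¹ • ∑ j, S (single a j 1) * T (single j b 1) := by
    rw [schurMul_matrixFunctional_apply, Finset.sum_eq_single a _ (by simp)]
    · simp only [single_mul_single_same, mul_one]
    · intro i _ hi
      simp only [single_mul_single_of_ne _ _ _ _ hi, map_zero, mul_zero, Finset.sum_const_zero]
  simp only [mul_apply, Fintype.sum_prod_type, choiMatrix_apply, hschur, Matrix.smul_apply,
    Matrix.sum_apply, smul_eq_mul, Finset.mul_sum]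
  exact Finset.sum_congr rfl fun j _ => Finset.sum_congr rfl fun m _ => by ring

theorem star_choiMatrix_apply {A : Matrix n n ℂ →ₗ[ℂ] Matrix n n ℂ}
    (hA : IsUndirected (matrixFunctional n) A) (p q : n × n) :
    star (choiMatrix A p q) = choiMatrix A p.swap q.swap := by
  have hn : (Fintype.card n : ℂ) ≠ 0 := Nat.cast_ne_zero.2 Fintype.card_ne_zero
  have hadj := isDualFrame_matrixFunctional.isGNSAdjoint_gnsAdjoint matrixFunctional_star
    matrixFunctional_star A (single p.1 q.1 1) (single p.2 q.2 1)
  rw [← show A = gnsAdjoint _ _ A from hA, ← star_gnsInner matrixFunctional_star,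
    gnsInner_matrixFunctional_single, gnsInner_matrixFunctional_single, star_mul', star_natCast]
    at hadj
  rw [choiMatrix_apply, choiMatrix_apply, star_mul', star_inv₀, star_natCast,
    mul_left_cancel₀ hn hadj]
  rfl

variable {K : ι → Matrix n n ℂ}

theorem star_compression_apply {A : Matrix n n ℂ →ₗ[ℂ] Matrix n n ℂ}
    (hund : IsUndirected (matrixFunctional n) A) (hK : ∀ a, (K a).IsHermitian) (a b : ι) :
    star (((krausMatrix K)ᴴ * choiMatrix A * krausMatrix K) a b) =
      ((krausMatrix K)ᴴ * choiMatrix A * krausMatrix K) a b := by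
  simp only [mul_apply, conjTranspose_apply, star_sum, star_mul', star_krausMatrix_apply hK,
    star_choiMatrix_apply hund]
  refine Fintype.sum_equiv (Equiv.prodComm n n) _ _ fun q => congrArg (· * _) ?_
  refine Fintype.sum_equiv (Equiv.prodComm n n) _ _ fun p => ?_
  rfl

variable [Fintype ι]

theorem eq_sum_of_choiMatrix_eq (hK : ∀ a, (K a).IsHermitian)
    {A : Matrix n n ℂ →ₗ[ℂ] Matrix n n ℂ} {Q : Matrix ι ι ℂ}
    (hA : choiMatrix A = (Fintype.card n : ℂ)⁻¹ • (krausMatrix K * Q * (krausMatrix K)ᴴ))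
    (x : Matrix n n ℂ) : A x = ∑ a, ∑ b, Q a b • (K a * x * K b) := by
  let T : Matrix n n ℂ →ₗ[ℂ] Matrix n n ℂ :=
    ∑ a, ∑ b, Q a b • (LinearMap.mulRight ℂ (K b) ∘ₗ LinearMap.mulLeft ℂ (K a))
  have hT (y) : T y = ∑ a, ∑ b, Q a b • (K a * y * K b) := by
    simp [T, LinearMap.sum_apply]
  rw [← hT, choiMatrix_injective (hA.trans (choiMatrix_eq_krausMatrix_mul hK hT).symm)]

theorem krausMatrix_mul_conjTranspose (hK : ∀ a, (K a).IsHermitian)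
    (hcomplete : ∀ x : Matrix n n ℂ, ∑ a, K a * x * K a = (Fintype.card n * trace x) • 1 - x) :
    krausMatrix K * (krausMatrix K)ᴴ =
      (Fintype.card n : ℂ) • (1 - choiMatrix (LinearMap.id : Matrix n n ℂ →ₗ[ℂ] _)) := by
  have hn : (Fintype.card n : ℂ) ≠ 0 := Nat.cast_ne_zero.2 Fintype.card_ne_zero
  ext p q
  have htrace : (trace (single p.1 q.1 (1 : ℂ)) • (1 : Matrix n n ℂ)) p.2 q.2 =
      (1 : Matrix (n × n) (n × n) ℂ) p q := by
    by_cases h : p.1 = q.1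
    · simp [h, one_apply, Prod.ext_iff]
    · simp [h, one_apply, Prod.ext_iff, trace_single_eq_of_ne]
  calc (krausMatrix K * (krausMatrix K)ᴴ) p q
      = (∑ a, K a * single p.1 q.1 (1 : ℂ) * K a) p.2 q.2 := by
        simp only [Matrix.sum_apply, mul_single_mul_apply hK]; rfl
    _ = _ := by
        rw [hcomplete, Matrix.smul_apply, Matrix.sub_apply, Matrix.sub_apply, ← htrace, mul_smul,
          choiMatrix_apply, smul_sub, smul_eq_mul _ (_ * _), mul_inv_cancel_left₀ hn]
        rfl

omit [DecidableEq n] [Nonempty n] in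
theorem compression_mul_self {P : Matrix n n ℂ} {V : Matrix ι n ℂ} {W : Matrix n ι ℂ} {c : ℂ}
    (hc : c ≠ 0) (hPP : P * P = P) (hPW : P * (W * V) = c • P) :
    (c⁻¹ • (V * P * W)) * (c⁻¹ • (V * P * W)) = c⁻¹ • (V * P * W) := by
  calc (c⁻¹ • (V * P * W)) * (c⁻¹ • (V * P * W))
      = (c⁻¹ * c⁻¹) • (V * (P * (W * V) * P) * W) := by
        simp only [Matrix.smul_mul, Matrix.mul_smul, smul_smul, Matrix.mul_assoc]
    _ = c⁻¹ • (V * P * W) := by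
        rw [hPW, Matrix.smul_mul, hPP, Matrix.mul_smul, Matrix.smul_mul, smul_smul, mul_assoc,
          inv_mul_cancel₀ hc, mul_one]

omit [DecidableEq n] [Nonempty n] in
theorem expand_compression {P : Matrix n n ℂ} {V : Matrix ι n ℂ} {W : Matrix n ι ℂ} {c : ℂ}
    (hc : c ≠ 0) (hPW : P * (W * V) = c • P) (hWP : W * V * P = c • P) :
    c⁻¹ • (W * (c⁻¹ • (V * P * W)) * V) = P := by
  calc c⁻¹ • (W * (c⁻¹ • (V * P * W)) * V) = (c⁻¹ * c⁻¹) • (W * V * P * (W * V)) := by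
        simp only [Matrix.smul_mul, Matrix.mul_smul, smul_smul, Matrix.mul_assoc]
    _ = P := by
        rw [hWP, Matrix.smul_mul, hPW, smul_smul, smul_smul, inv_mul_cancel_right₀ hc,
          inv_mul_cancel₀ hc, one_smul]

theorem choiMatrix_mul_krausMatrix {A : Matrix n n ℂ →ₗ[ℂ] Matrix n n ℂ}
    (hloop : IsLoopfree (matrixFunctional n) A) (hK : ∀ a, (K a).IsHermitian)
    (hcomplete : ∀ x : Matrix n n ℂ, ∑ a, K a * x * K a = (Fintype.card n * trace x) • 1 - x) :
    choiMatrix A * (krausMatrix K * (krausMatrix K)ᴴ) = (Fintype.card n : ℂ) • choiMatrix A := by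
  have horth : choiMatrix A * choiMatrix LinearMap.id = 0 := by
    rw [← choiMatrix_schurMul, show schurMul _ A _ = 0 from hloop]
    exact Matrix.ext fun _ _ => mul_zero _
  rw [krausMatrix_mul_conjTranspose hK hcomplete, Matrix.mul_smul, Matrix.mul_sub, Matrix.mul_one,
    horth, sub_zero]

theorem exists_symm_projection_eq_sum {A : Matrix n n ℂ →ₗ[ℂ] Matrix n n ℂ}
    (hA : IsQuantumGraph (matrixFunctional n) A) (hund : IsUndirected (matrixFunctional n) A)
    (hloop : IsLoopfree (matrixFunctional n) A) (hK : ∀ a, (K a).IsHermitian)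
    (hcomplete : ∀ x : Matrix n n ℂ, ∑ a, K a * x * K a = (Fintype.card n * trace x) • 1 - x) :
    ∃ Q : Matrix ι ι ℝ, Q.IsSymm ∧ Q * Q = Q ∧
      ∀ x, A x = ∑ a, ∑ b, (Q a b : ℂ) • (K a * x * K b) := by
  set P := choiMatrix A
  set W := krausMatrix K
  have hn : (Fintype.card n : ℂ) ≠ 0 := Nat.cast_ne_zero.2 Fintype.card_ne_zero
  have hPP : P * P = P := by rw [← choiMatrix_schurMul, hA.schur_idempotent]
  have hPH : Pᴴ = P := isHermitian_choiMatrix hA.map_star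
  have hPW : P * (W * Wᴴ) = (Fintype.card n : ℂ) • P :=
    choiMatrix_mul_krausMatrix hloop hK hcomplete
  have hWP : W * Wᴴ * P = (Fintype.card n : ℂ) • P := by
    simpa only [conjTranspose_mul, conjTranspose_conjTranspose, conjTranspose_smul, hPH,
      star_natCast] using congrArg conjTranspose hPW
  set R := (Fintype.card n : ℂ)⁻¹ • (Wᴴ * P * W) with hR
  have hRR : R * R = R := compression_mul_self hn hPP hPW
  have hPR : P = (Fintype.card n : ℂ)⁻¹ • (W * R * Wᴴ) := (expand_compression hn hPW hWP).symm
  have hRH : R.IsHermitian := by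
    rw [IsHermitian, hR, conjTranspose_smul, conjTranspose_mul, conjTranspose_mul,
      conjTranspose_conjTranspose, hPH, Matrix.mul_assoc, star_inv₀, star_natCast]
  have hRreal (a b : ι) : ((R a b).re : ℂ) = R a b := by
    refine Complex.conj_eq_iff_re.1 ?_
    rw [hR, Matrix.smul_apply, smul_eq_mul, map_mul, map_inv₀, map_natCast]
    exact congrArg _ (star_compression_apply hund hK a b)
  refine ⟨R.map Complex.re, ?_, ?_, fun x => ?_⟩
  · exact IsSymm.ext fun a b => by
      rw [map_apply, map_apply, ← hRH.apply a b, Complex.star_def, Complex.conj_re]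
  · refine Matrix.map_injective Complex.ofReal_injective (Matrix.ext fun a b => ?_)
    simp only [map_apply, mul_apply, Complex.ofReal_sum, Complex.ofReal_mul, hRreal]
    exact congrFun₂ hRR a b
  · simp only [map_apply, hRreal]
    exact eq_sum_of_choiMatrix_eq hK hPR x

end MatrixAlgebra

section Projections

theorem trace_conjStarAlgAut {𝕜 n : Type*} [RCLike 𝕜] [Fintype n] [DecidableEq n]
    (U : unitary (Matrix n n 𝕜)) (x : Matrix n n 𝕜) :
    trace (Unitary.conjStarAlgAut 𝕜 _ U x) = trace x := by
  rw [Unitary.conjStarAlgAut_apply, trace_mul_comm, ← Matrix.mul_assoc, Unitary.coe_star_mul_self,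
    Matrix.one_mul]

theorem exists_eq_ite_fin_three :
    ∀ d : Fin 3 → Bool, ∃ k p q, ∀ i, d i = if i = k then p else q := by
  decide

theorem exists_eq_ite_vecMulVec_fin_three {Q : Matrix (Fin 3) (Fin 3) ℝ} (hQ : Q.IsSymm)
    (hQQ : Q * Q = Q) :
    ∃ v : Fin 3 → ℝ, v ⬝ᵥ v = 1 ∧ ∃ p q : Bool,
      Q = (if p then vecMulVec v v else 0) + if q then 1 - vecMulVec v v else 0 := by
  have hherm : Q.IsHermitian := hQ
  set φ := Unitary.conjStarAlgAut ℝ _ hherm.eigenvectorUnitary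
  set d := hherm.eigenvalues
  have hφ : Q = φ (diagonal d) := hherm.spectral_theorem
  have hd (i) : d i = 0 ∨ d i = 1 := by
    rw [hφ, ← map_mul] at hQQ
    have hdd := congrFun₂ (EquivLike.injective φ hQQ) i i
    rw [diagonal_mul_diagonal, diagonal_apply_eq, diagonal_apply_eq] at hdd
    exact (mul_left_eq_self₀.1 hdd).symm
  obtain ⟨k, p, q, hkpq⟩ := exists_eq_ite_fin_three fun i => decide (d i = 1)
  set v : Fin 3 → ℝ := fun i => (hherm.eigenvectorUnitary : Matrix _ _ ℝ) i k
  have hv : φ (single k k 1) = vecMulVec v v := by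
    ext i j
    simp [φ, v, Unitary.conjStarAlgAut_apply, mul_apply, single_apply, vecMulVec_apply, ite_and]
  have hdiag : diagonal d =
      (if p then single k k 1 else 0) + if q then 1 - single k k 1 else 0 := by
    have hdi (i) : d i = if (if i = k then p else q) then 1 else 0 := by
      rw [← hkpq i]
      rcases hd i with h | h <;> simp [h]
    rw [funext hdi]
    ext i j
    cases p <;> cases q <;> simp [diagonal_apply, single_apply, one_apply] <;> grind
  refine ⟨v, ?_, p, q, ?_⟩
  · rw [← trace_vecMulVec, ← hv, trace_conjStarAlgAut, trace_single_eq_same]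
  · rw [hφ, hdiag, map_add, apply_ite φ, apply_ite φ, map_sub, map_one, map_zero, hv]

end Projections

section AxisGraphs

variable {n : Type*} [Fintype n] [DecidableEq n]

/-- The quantum graph on `M_n` given by a selfadjoint unitary `H` of trace zero: `p` switches on the
edge `x ↦ HxH`, and `q` switches on all remaining non-loop edges. -/
def axisGraph (H : Matrix n n ℂ) (p q : Bool) : Matrix n n ℂ →ₗ[ℂ] Matrix n n ℂ :=
  (if p then LinearMap.mulLeftRight ℂ (H, H) else 0) +
    if q then (matrixFunctional n).smulRight 1 - LinearMap.id - LinearMap.mulLeftRight ℂ (H, H)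
    else 0

theorem axisGraph_apply (H : Matrix n n ℂ) (p q : Bool) (x : Matrix n n ℂ) :
    axisGraph H p q x = (if p then H * x * H else 0) +
      if q then matrixFunctional n x • 1 - x - H * x * H else 0 := by
  cases p <;> cases q <;> simp [axisGraph]

theorem axisGraph_neg (H : Matrix n n ℂ) (p q : Bool) : axisGraph (-H) p q = axisGraph H p q :=
  LinearMap.ext fun x => by
    simp only [axisGraph_apply, Matrix.neg_mul, Matrix.mul_neg, neg_neg]

theorem axisGraph_isomorphic_conj (U : unitary (Matrix n n ℂ)) (H : Matrix n n ℂ) (p q : Bool) :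
    QuantumGraphIsomorphic (matrixFunctional n) (axisGraph H p q) (matrixFunctional n)
      (axisGraph (Unitary.conjStarAlgAut ℂ _ U H) p q) := by
  have htrace (x) : matrixFunctional n (Unitary.conjStarAlgAut ℂ _ U x) = matrixFunctional n x := by
    rw [matrixFunctional_apply, matrixFunctional_apply, trace_conjStarAlgAut]
  refine ⟨Unitary.conjStarAlgAut ℂ _ U, htrace, fun x => ?_⟩
  cases p <;> cases q <;>
    simp only [axisGraph_apply, Bool.false_eq_true, if_true, if_false, map_add, map_sub, map_smul,
      map_mul, map_one, map_zero, htrace]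

theorem sum_smul_eq_axisGraph {ι : Type*} [Fintype ι] [DecidableEq ι] {K : ι → Matrix n n ℂ}
    (hcomplete : ∀ x : Matrix n n ℂ, ∑ a, K a * x * K a = (Fintype.card n * trace x) • 1 - x)
    (v : ι → ℝ) (p q : Bool) (x : Matrix n n ℂ) :
    ∑ a, ∑ b, ((((if p then vecMulVec v v else 0) + if q then 1 - vecMulVec v v else 0 :
      Matrix ι ι ℝ) a b : ℝ) : ℂ) • (K a * x * K b) = axisGraph (∑ a, (v a : ℂ) • K a) p q x := by
  have hv : ∑ a, ∑ b, ((vecMulVec v v a b : ℝ) : ℂ) • (K a * x * K b) =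
      (∑ a, (v a : ℂ) • K a) * x * ∑ a, (v a : ℂ) • K a := by
    simp only [Finset.sum_mul, Finset.mul_sum, Matrix.smul_mul, Matrix.mul_smul, smul_smul,
      vecMulVec_apply, Complex.ofReal_mul]
    rw [Finset.sum_comm]
    simp only [mul_comm]
  have hone : ∑ a, ∑ b, (((1 : Matrix ι ι ℝ) a b : ℝ) : ℂ) • (K a * x * K b) =
      matrixFunctional n x • 1 - x := by
    simp [one_apply, hcomplete, matrixFunctional_apply]
  rw [axisGraph_apply, ← hv, ← hone]
  cases p <;> cases q <;>
    simp [sub_smul, Finset.sum_sub_distrib]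

end AxisGraphs

section Pauli

/-- The Pauli matrices `σ_x`, `σ_y`, `σ_z`. -/
def pauli : Fin 3 → Matrix (Fin 2) (Fin 2) ℂ :=
  ![!![0, 1; 1, 0], !![0, -Complex.I; Complex.I, 0], !![1, 0; 0, -1]]

theorem isHermitian_pauli (a : Fin 3) : (pauli a).IsHermitian := by
  ext i j
  fin_cases a <;> fin_cases i <;> fin_cases j <;> simp [pauli]

theorem trace_pauli (a : Fin 3) : trace (pauli a) = 0 := by
  fin_cases a <;> simp [pauli, trace_fin_two]

theorem pauli_complete (x : Matrix (Fin 2) (Fin 2) ℂ) :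
    ∑ a, pauli a * x * pauli a = (Fintype.card (Fin 2) * trace x) • 1 - x := by
  rw [eta_fin_two x]
  ext i j
  fin_cases i <;> fin_cases j <;>
    simp [pauli, Fin.sum_univ_three, trace_fin_two] <;> ring_nf <;> simp <;> ring

theorem sum_smul_pauli_mul_self (v : Fin 3 → ℝ) :
    (∑ a, (v a : ℂ) • pauli a) * ∑ a, (v a : ℂ) • pauli a = ((v ⬝ᵥ v : ℝ) : ℂ) • 1 := by
  ext i j
  fin_cases i <;> fin_cases j <;>
    simp [pauli, Fin.sum_univ_three, dotProduct, mul_apply, Fin.sum_univ_two] <;>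
    ring_nf <;> simp

theorem exists_conjStarAlgAut_pauli_two {H : Matrix (Fin 2) (Fin 2) ℂ} (hH : H.IsHermitian)
    (hHH : H * H = 1) (htr : trace H = 0) :
    ∃ U, H = Unitary.conjStarAlgAut ℂ _ U (pauli 2) ∨
      H = -Unitary.conjStarAlgAut ℂ _ U (pauli 2) := by
  set d : Fin 2 → ℂ := fun i => hH.eigenvalues i
  have hφ : H = Unitary.conjStarAlgAut ℂ _ hH.eigenvectorUnitary (diagonal d) :=
    hH.spectral_theorem
  refine ⟨hH.eigenvectorUnitary, ?_⟩
  set φ := Unitary.conjStarAlgAut ℂ _ hH.eigenvectorUnitary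
  have hd : d 0 * d 0 = 1 := by
    rw [hφ, ← map_mul, ← map_one φ] at hHH
    simpa using congrFun₂ (EquivLike.injective φ hHH) 0 0
  have hneg : d 1 = -d 0 := by
    rw [hφ, trace_conjStarAlgAut, trace_diagonal, Fin.sum_univ_two, add_comm] at htr
    exact eq_neg_of_add_eq_zero_left htr
  have hdiag : diagonal d = d 0 • pauli 2 := by
    ext i j
    fin_cases i <;> fin_cases j <;> simp [pauli, hneg]
  rw [hφ, hdiag, map_smul]
  exact (mul_self_eq_one_iff.1 hd).imp (fun h => by rw [h, one_smul])
    fun h => by rw [h, neg_smul, one_smul]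

theorem exists_isomorphic_axisGraph {A : Matrix (Fin 2) (Fin 2) ℂ →ₗ[ℂ] Matrix (Fin 2) (Fin 2) ℂ}
    (hA : IsQuantumGraph (matrixFunctional (Fin 2)) A)
    (hund : IsUndirected (matrixFunctional (Fin 2)) A)
    (hloop : IsLoopfree (matrixFunctional (Fin 2)) A) :
    ∃ p q, QuantumGraphIsomorphic (matrixFunctional (Fin 2)) A (matrixFunctional (Fin 2))
      (axisGraph (pauli 2) p q) := by
  obtain ⟨Q, hQ, hQQ, hAQ⟩ :=
    exists_symm_projection_eq_sum hA hund hloop isHermitian_pauli pauli_complete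
  obtain ⟨v, hv, p, q, rfl⟩ := exists_eq_ite_vecMulVec_fin_three hQ hQQ
  set H := ∑ a, (v a : ℂ) • pauli a with hH
  have hAH : A = axisGraph H p q :=
    LinearMap.ext fun x => (hAQ x).trans (sum_smul_eq_axisGraph pauli_complete v p q x)
  have hHH : H * H = 1 := by
    rw [sum_smul_pauli_mul_self, hv, Complex.ofReal_one, one_smul]
  have hherm : H.IsHermitian := by
    simp only [IsHermitian, hH, conjTranspose_sum, conjTranspose_smul, (isHermitian_pauli _).eq,
      Complex.star_def, Complex.conj_ofReal]
  have htr : trace H = 0 := by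
    simp only [hH, trace_sum, trace_smul, trace_pauli, smul_zero, Finset.sum_const_zero]
  obtain ⟨U, hU⟩ := exists_conjStarAlgAut_pauli_two hherm hHH htr
  have hconj : axisGraph H p q = axisGraph (Unitary.conjStarAlgAut ℂ _ U (pauli 2)) p q := by
    rcases hU with h | h <;> simp only [h, axisGraph_neg]
  exact ⟨p, q, hAH ▸ hconj ▸ (axisGraph_isomorphic_conj U (pauli 2) p q).symm⟩

end Pauli

/-! ### Classical graphs -/

section ClassicalGraphs

variable {V W : Type*} [Fintype V] [Fintype W]

theorem classicalFunctional_apply (f : V → ℂ) : classicalFunctional V f = ∑ v, f v := by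
  simp only [classicalFunctional, LinearMap.sum_apply, LinearMap.proj_apply]

theorem classicalFunctional_star (f : V → ℂ) :
    classicalFunctional V (star f) = star (classicalFunctional V f) := by
  simp only [classicalFunctional_apply, star_sum, Pi.star_apply]

theorem gnsInner_classicalFunctional (f g : V → ℂ) :
    gnsInner (classicalFunctional V) f g = ∑ v, star (f v) * g v :=
  classicalFunctional_apply _

theorem isDualFrame_classicalFunctional [DecidableEq V] :
    IsDualFrame (classicalFunctional V) (fun v => Pi.single v 1) fun v => Pi.single v 1 :=
  fun f => by
    have hcoeff (v : V) : gnsInner (classicalFunctional V) (Pi.single v 1) f = f v := by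
      simp [gnsInner_classicalFunctional, Pi.single_apply, apply_ite star]
    simp only [hcoeff]
    exact (pi_eq_sum_univ' f).symm

theorem schurMul_classicalFunctional_apply [DecidableEq V] (S T : (V → ℂ) →ₗ[ℂ] V → ℂ)
    (f : V → ℂ) : schurMul (classicalFunctional V) S T f =
      ∑ v, f v • (S (Pi.single v 1) * T (Pi.single v 1)) := by
  rw [isDualFrame_classicalFunctional.schurMul_apply classicalFunctional_star]
  have hsingle (v : V) : star (Pi.single v (1 : ℂ)) * f = f v • Pi.single v 1 := by
    rw [← Pi.single_star, star_one]
    ext w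
    by_cases h : w = v <;> simp [h]
  simp only [hsingle, map_smul, mul_smul_comm]

theorem isQuantumSet_classicalFunctional : IsQuantumSet (classicalFunctional V) where
  finiteDimensional := inferInstance
  nonneg f := by
    have h : classicalFunctional V (star f * f) = ((∑ v, Complex.normSq (f v) : ℝ) : ℂ) := by
      rw [classicalFunctional_apply, Complex.ofReal_sum]
      exact Finset.sum_congr rfl fun v _ => (Complex.normSq_eq_conj_mul_self).symm
    rw [h]
    exact ⟨Finset.sum_nonneg fun v _ => Complex.normSq_nonneg _, Complex.ofReal_im _⟩
  faithful f hf := by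
    have h : ∑ v, Complex.normSq (f v) = 0 := by
      rw [← Complex.ofReal_inj, Complex.ofReal_sum, Complex.ofReal_zero, ← hf,
        classicalFunctional_apply]
      exact Finset.sum_congr rfl fun v _ => Complex.normSq_eq_conj_mul_self
    exact funext fun v => Complex.normSq_eq_zero.1
      ((Finset.sum_eq_zero_iff_of_nonneg fun v _ => Complex.normSq_nonneg _).1 h v
        (Finset.mem_univ v))
  mul_comul := by
    classical
    refine LinearMap.ext fun f => ?_
    rw [← schurMul_id_id, schurMul_classicalFunctional_apply]
    simp only [LinearMap.id_apply, ← Pi.single_mul, mul_one]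
    exact (pi_eq_sum_univ' f).symm

theorem adjacencyMap_apply (r : V → V → Prop) [DecidableRel r] (f : V → ℂ) (w : V) :
    adjacencyMap r f w = ∑ v, if r v w then f v else 0 := by
  simp only [adjacencyMap, toLin'_apply, mulVec, dotProduct, of_apply, ite_mul, one_mul, zero_mul]

theorem isQuantumGraph_adjacencyMap (r : V → V → Prop) :
    IsQuantumGraph (classicalFunctional V) (adjacencyMap r) where
  schur_idempotent := by
    classical
    have hentry (v w : V) : adjacencyMap r (Pi.single v 1) w = if r v w then 1 else 0 := by
      simp [adjacencyMap]
    refine LinearMap.ext fun f => funext fun w => ?_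
    rw [schurMul_classicalFunctional_apply, adjacencyMap_apply, Finset.sum_apply]
    refine Finset.sum_congr rfl fun v _ => ?_
    by_cases h : r v w <;> simp [hentry, h]
  map_star f := by
    classical
    ext w
    simp only [adjacencyMap_apply, Pi.star_apply, star_sum, apply_ite star, star_zero]

theorem adjacencyMap_isomorphic_of_equiv (e : V ≃ W) {r : V → V → Prop} {s : W → W → Prop}
    (h : ∀ v w, s (e v) (e w) ↔ r v w) :
    QuantumGraphIsomorphic (classicalFunctional W) (adjacencyMap s) (classicalFunctional V)
      (adjacencyMap r) := by
  classical
  let φ : (W → ℂ) ≃⋆ₐ[ℂ] (V → ℂ) :=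
    { toFun := fun f v => f (e v)
      invFun := fun f w => f (e.symm w)
      left_inv := fun f => funext fun w => congrArg f (e.apply_symm_apply w)
      right_inv := fun f => funext fun v => congrArg f (e.symm_apply_apply v)
      map_mul' := fun _ _ => rfl
      map_add' := fun _ _ => rfl
      map_star' := fun _ => rfl
      map_smul' := fun _ _ => rfl }
  have hφ (f v) : φ f v = f (e v) := rfl
  refine ⟨φ, fun f => ?_, fun f => funext fun v => ?_⟩
  · simp only [classicalFunctional_apply, hφ, e.sum_comp]
  · rw [hφ, adjacencyMap_apply, adjacencyMap_apply, ← e.sum_comp]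
    simp only [h, hφ]

end ClassicalGraphs

/-! ### Nice error bases -/

section StarHoms

variable {V B C n : Type*} [Fintype V] [Fintype n] [DecidableEq n]
  [Ring B] [StarRing B] [Algebra ℂ B] [Ring C] [StarRing C] [Algebra ℂ C] [StarModule ℂ C]

omit [Fintype V] [StarModule ℂ C] in
/-- The star-homomorphism `B → C^V ⊗ M_n` whose component at `v : V` is `φ v : B → C ⊗ M_n`. -/
def piMatrixStarAlgHom (φ : V → B →⋆ₐ[ℂ] Matrix n n C) : B →⋆ₐ[ℂ] Matrix n n (V → C) where
  toFun x := of fun i j v => φ v x i j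
  map_one' := by
    ext i j v
    by_cases h : i = j <;> simp [one_apply, h]
  map_mul' x y := by
    ext i j v
    simp only [map_mul, mul_apply, of_apply, Finset.sum_apply, Pi.mul_apply]
  map_zero' := by
    ext i j v
    simp only [map_zero, Matrix.zero_apply, of_apply, Pi.zero_apply]
  map_add' x y := by
    ext i j v
    simp only [map_add, Matrix.add_apply, of_apply, Pi.add_apply]
  commutes' c := by
    ext i j v
    by_cases h : i = j <;> simp [algebraMap_matrix_apply, AlgHomClass.commutes, h]
  map_star' x := by
    ext i j v
    simp only [map_star, star_apply, of_apply, Pi.star_apply]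

omit [Fintype V] [StarModule ℂ C] in
theorem piMatrixStarAlgHom_apply (φ : V → B →⋆ₐ[ℂ] Matrix n n C) (x : B) (i j : n) (v : V) :
    piMatrixStarAlgHom φ x i j v = φ v x i j :=
  rfl

/-- The star-homomorphism `ℂ^V → C`, `f ↦ ∑ v, f v • P v`, given by a partition of unity into
projections `P v`. -/
def starAlgHomOfProjections {P : V → C} (hP : CompleteOrthogonalIdempotents P)
    (hstar : ∀ v, star (P v) = P v) : (V → ℂ) →⋆ₐ[ℂ] C where
  toFun f := ∑ v, f v • P v
  map_one' := by simp only [Pi.one_apply, one_smul, hP.complete]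
  map_mul' f g := by
    classical
    simp only [Finset.sum_mul_sum, smul_mul_smul_comm, hP.mul_eq, Pi.mul_apply, smul_ite,
      smul_zero, Finset.sum_ite_eq, Finset.mem_univ, if_true]
  map_zero' := by simp only [Pi.zero_apply, zero_smul, Finset.sum_const_zero]
  map_add' f g := by simp only [Pi.add_apply, add_smul, Finset.sum_add_distrib]
  commutes' c := by
    simp only [Pi.algebraMap_apply, Algebra.algebraMap_self_apply, ← Finset.smul_sum, hP.complete,
      Algebra.algebraMap_eq_smul_one]
  map_star' f := by simp only [star_sum, star_smul, hstar, Pi.star_apply]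

theorem starAlgHomOfProjections_apply {P : V → C} (hP : CompleteOrthogonalIdempotents P)
    (hstar : ∀ v, star (P v) = P v) (f : V → ℂ) :
    starAlgHomOfProjections hP hstar f = ∑ v, f v • P v :=
  rfl

end StarHoms

section CayleyGraphs

variable {Γ : Type*} [AddGroup Γ] [Fintype Γ]

theorem adjacencyMap_neg_add_mem_apply (S : Finset Γ) (f : Γ → ℂ) (w : Γ) :
    adjacencyMap (fun v w => -w + v ∈ S) f w = ∑ s ∈ S, f (w + s) := by
  classical
  rw [adjacencyMap_apply, ← Equiv.sum_comp (Equiv.addLeft w)]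
  simp only [Equiv.coe_addLeft, neg_add_cancel_left, Finset.sum_ite_mem, Finset.univ_inter]

end CayleyGraphs

section NiceErrorBases

variable {n Γ : Type*} [Fintype n] [DecidableEq n] [AddGroup Γ] [Fintype Γ]

/-- A nice error basis: unitary matrices that are pairwise orthogonal for the trace inner product,
as many as there are matrix units, and indexed by a group that acts on the matrices by
conjugation. Stating multiplicativity for the conjugations avoids the scalar cocycle. -/
structure IsNiceErrorBasis (τ : Γ → unitary (Matrix n n ℂ)) : Prop where
  conj_add : ∀ v w, Unitary.conjStarAlgAut ℂ _ (τ (v + w)) =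
    Unitary.conjStarAlgAut ℂ _ (τ v) * Unitary.conjStarAlgAut ℂ _ (τ w)
  trace_eq_zero : ∀ v w, v ≠ w → trace ((τ v : Matrix n n ℂ) * star (τ w : Matrix n n ℂ)) = 0
  card_eq : Fintype.card Γ = Fintype.card n ^ 2

/-- The quantum graph on `M_n` attached to a set `S` of indices of a nice error basis `τ`; the
matrices `τ s` with `s ∈ S` are its Kraus operators. -/
def cayleyQuantumGraph (τ : Γ → unitary (Matrix n n ℂ)) (S : Finset Γ) :
    Matrix n n ℂ →ₗ[ℂ] Matrix n n ℂ :=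
  ∑ s ∈ S, (Unitary.conjStarAlgAut ℂ _ (τ s)).toAlgEquiv.toLinearMap

omit [AddGroup Γ] [Fintype Γ] in
theorem cayleyQuantumGraph_apply (τ : Γ → unitary (Matrix n n ℂ)) (S : Finset Γ)
    (x : Matrix n n ℂ) :
    cayleyQuantumGraph τ S x = ∑ s ∈ S, Unitary.conjStarAlgAut ℂ _ (τ s) x :=
  LinearMap.sum_apply _ _ _

/-- The projection in `M_n ⊗ M_n` onto the line spanned by the vectorisation of `τ v`, written as
a matrix with entries in `M_n`. -/
def errorProjection (τ : Γ → unitary (Matrix n n ℂ)) (v : Γ) : Matrix n n (Matrix n n ℂ) :=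
  of fun i j => (Fintype.card n : ℂ)⁻¹ • Unitary.conjStarAlgAut ℂ _ (τ v) (single i j 1)

omit [AddGroup Γ] [Fintype Γ] in
theorem star_errorProjection (τ : Γ → unitary (Matrix n n ℂ)) (v : Γ) :
    star (errorProjection τ v) = errorProjection τ v := by
  ext1 i j
  simp only [errorProjection, star_apply, of_apply, star_smul, star_inv₀, star_natCast,
    ← StarHomClass.map_star, star_eq_conjTranspose, conjTranspose_single, star_one]

omit [AddGroup Γ] [Fintype Γ] in
theorem errorProjection_mul_apply (τ : Γ → unitary (Matrix n n ℂ)) (v w : Γ) (i k : n) :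
    (errorProjection τ v * errorProjection τ w) i k =
      ((Fintype.card n : ℂ)⁻¹ * ((Fintype.card n : ℂ)⁻¹ *
        trace (star (τ v : Matrix n n ℂ) * (τ w : Matrix n n ℂ)))) •
          ((τ v : Matrix n n ℂ) * single i k 1 * star (τ w : Matrix n n ℂ)) := by
  have hsum (M : Matrix n n ℂ) :
      ∑ j, single i j 1 * M * single j k 1 = trace M • single i k (1 : ℂ) := by
    simp only [single_mul_mul_single, one_mul, mul_one, trace, diag_apply, Finset.sum_smul,
      smul_single, smul_eq_mul]
  have hassoc (j : n) : (τ v : Matrix n n ℂ) * single i j 1 * star (τ v : Matrix n n ℂ) *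
        ((τ w : Matrix n n ℂ) * single j k 1 * star (τ w : Matrix n n ℂ)) =
      (τ v : Matrix n n ℂ) * (single i j 1 * (star (τ v : Matrix n n ℂ) * (τ w : Matrix n n ℂ)) *
          single j k 1) *
        star (τ w : Matrix n n ℂ) := by
    simp only [Matrix.mul_assoc]
  simp only [errorProjection, mul_apply, of_apply, Unitary.conjStarAlgAut_apply, smul_mul_smul_comm]
  rw [← Finset.smul_sum]
  simp only [hassoc]
  rw [← Finset.sum_mul, ← Finset.mul_sum, hsum, Matrix.mul_smul, Matrix.smul_mul, smul_smul,
    mul_assoc]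

namespace IsNiceErrorBasis

variable {τ : Γ → unitary (Matrix n n ℂ)} (hτ : IsNiceErrorBasis τ)
include hτ

theorem nonempty : Nonempty n := by
  rw [← Fintype.card_pos_iff]
  exact Nat.pos_of_ne_zero fun h => Fintype.card_ne_zero (hτ.card_eq.trans (by rw [h]; rfl))

theorem sum_star_mul (i j k l : n) :
    ∑ v, star (τ v i j) * τ v k l = if i = k ∧ j = l then (Fintype.card n : ℂ) else 0 := by
  classical
  have := hτ.nonempty
  have hn : (Fintype.card n : ℂ) ≠ 0 := Nat.cast_ne_zero.2 Fintype.card_ne_zero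
  let T : Matrix Γ (n × n) ℂ := of fun v p => τ v p.1 p.2
  have hgram : T * ((Fintype.card n : ℂ)⁻¹ • Tᴴ) = 1 := by
    ext v w
    have htrace : (T * Tᴴ) v w = trace ((τ v : Matrix n n ℂ) * star (τ w : Matrix n n ℂ)) := by
      simp only [T, mul_apply, conjTranspose_apply, of_apply, trace, diag_apply,
        Fintype.sum_prod_type, star_apply]
    rw [Matrix.mul_smul, Matrix.smul_apply, htrace]
    by_cases h : v = w
    · rw [h, Unitary.mul_star_self_of_mem (τ w).2, trace_one, smul_eq_mul, inv_mul_cancel₀ hn,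
        one_apply_eq]
    · rw [hτ.trace_eq_zero v w h, smul_zero, one_apply_ne h]
  have hcard : Fintype.card Γ = Fintype.card (n × n) := by
    rw [hτ.card_eq, Fintype.card_prod, sq]
  have hentry := congrArg (Fintype.card n * · (i, j) (k, l) : Matrix (n × n) (n × n) ℂ → ℂ)
    ((mul_eq_one_comm_of_card_eq _ _ _ hcard).1 hgram)
  simpa [T, mul_apply, one_apply, hn, mul_assoc, ← Finset.mul_sum] using hentry

theorem sum_conj (x : Matrix n n ℂ) :
    ∑ v, Unitary.conjStarAlgAut ℂ _ (τ v) x = matrixFunctional n x • 1 := by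
  ext i l
  calc (∑ v, Unitary.conjStarAlgAut ℂ _ (τ v) x) i l
      = ∑ v, ∑ k, (∑ j, τ v i j * x j k) * star (τ v l k) := by
        simp only [Unitary.conjStarAlgAut_apply, Matrix.sum_apply, mul_apply, star_apply]
    _ = ∑ k, ∑ j, x j k * ∑ v, star (τ v l k) * τ v i j := by
        simp only [Finset.mul_sum, Finset.sum_mul]
        rw [Finset.sum_comm]
        refine Finset.sum_congr rfl fun k _ => ?_
        rw [Finset.sum_comm]
        exact Finset.sum_congr rfl fun j _ => Finset.sum_congr rfl fun v _ => by ring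
    _ = (matrixFunctional n x • (1 : Matrix n n ℂ)) i l := by
        simp only [hτ.sum_star_mul, matrixFunctional_apply]
        by_cases h : l = i <;>
          simp [h, Ne.symm, one_apply, Finset.mul_sum, trace, mul_comm]

theorem completeOrthogonalIdempotents_errorProjection :
    CompleteOrthogonalIdempotents (errorProjection τ) := by
  have := hτ.nonempty
  have hn : (Fintype.card n : ℂ) ≠ 0 := Nat.cast_ne_zero.2 Fintype.card_ne_zero
  refine ⟨⟨fun v => ?_, fun v w h => ?_⟩, ?_⟩ <;> ext1 i k
  · rw [errorProjection_mul_apply, Unitary.star_mul_self_of_mem (τ v).2, trace_one,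
      inv_mul_cancel₀ hn, mul_one]
    rfl
  · rw [errorProjection_mul_apply, trace_mul_comm, hτ.trace_eq_zero w v h.symm, mul_zero, mul_zero]
    exact zero_smul ℂ _
  · simp only [errorProjection, Matrix.sum_apply, of_apply]
    rw [← Finset.smul_sum, hτ.sum_conj, matrixFunctional_apply, smul_smul,
      inv_mul_cancel_left₀ hn]
    by_cases h : i = k
    · rw [h, trace_single_eq_same, one_smul, one_apply_eq]
    · rw [trace_single_eq_of_ne i k 1 h, zero_smul, one_apply_ne h]

end IsNiceErrorBasis

section QuantumIsomorphism

variable {d : ℕ} {Γ : Type*} [AddGroup Γ] [Fintype Γ]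
  {τ : Γ → unitary (Matrix (Fin d) (Fin d) ℂ)}

theorem IsNiceErrorBasis.finrank_eq (hτ : IsNiceErrorBasis τ) :
    Module.finrank ℂ (Matrix (Fin d) (Fin d) ℂ) = Module.finrank ℂ (Γ → ℂ) := by
  rw [Module.finrank_matrix, Module.finrank_self, Module.finrank_fintype_fun_eq_card, hτ.card_eq,
    mul_one, sq]

theorem IsNiceErrorBasis.dim_pos (hτ : IsNiceErrorBasis τ) : 0 < d :=
  Fin.pos_iff_nonempty.2 hτ.nonempty

theorem IsNiceErrorBasis.cayleyQuantumGraph_quantumIsomorphic (hτ : IsNiceErrorBasis τ)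
    (S : Finset Γ) :
    QuantumGraphQuantumIsomorphic (matrixFunctional (Fin d)) (cayleyQuantumGraph τ S)
      (classicalFunctional Γ) (adjacencyMap fun v w => -w + v ∈ S) := by
  have := hτ.nonempty
  refine ⟨d, piMatrixStarAlgHom fun v => (Unitary.conjStarAlgAut ℂ _ (τ v) : _ →⋆ₐ[ℂ] _),
    hτ.dim_pos, .of_functional_map isDualFrame_matrixFunctional hτ.finrank_eq fun x i j => ?_,
    fun x => ?_⟩
  · calc _ = (∑ v, Unitary.conjStarAlgAut ℂ _ (τ v) x) i j := by
          rw [classicalFunctional_apply, Matrix.sum_apply]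
          rfl
      _ = _ := by
          rw [hτ.sum_conj, Matrix.smul_apply, one_apply, smul_eq_mul, mul_ite, mul_one, mul_zero]
  · ext i j v
    rw [map_apply, adjacencyMap_neg_add_mem_apply, piMatrixStarAlgHom_apply,
      cayleyQuantumGraph_apply, map_sum, Matrix.sum_apply]
    simp only [piMatrixStarAlgHom_apply, hτ.conj_add]
    rfl

theorem IsNiceErrorBasis.quantumIsomorphic_cayleyQuantumGraph (hτ : IsNiceErrorBasis τ)
    (S : Finset Γ) :
    QuantumGraphQuantumIsomorphic (classicalFunctional Γ) (adjacencyMap fun v w => -w + v ∈ S)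
      (matrixFunctional (Fin d)) (cayleyQuantumGraph τ S) := by
  classical
  have hd : (d : ℂ) ≠ 0 := Nat.cast_ne_zero.2 hτ.dim_pos.ne'
  have hP : CompleteOrthogonalIdempotents fun v => errorProjection τ (-v) :=
    (CompleteOrthogonalIdempotents.equiv (Equiv.neg Γ)).2
      hτ.completeOrthogonalIdempotents_errorProjection
  refine ⟨d, starAlgHomOfProjections hP fun v => star_errorProjection τ (-v), hτ.dim_pos,
    .of_functional_map isDualFrame_classicalFunctional hτ.finrank_eq.symm fun f i j => ?_,
    fun f => ?_⟩
  · have htrace (v : Γ) :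
        matrixFunctional (Fin d) (errorProjection τ v i j) = if i = j then 1 else 0 := by
      rw [errorProjection, of_apply, map_smul, matrixFunctional_apply, trace_conjStarAlgAut]
      by_cases h : i = j <;> simp [h, hd, trace_single_eq_of_ne]
    rw [starAlgHomOfProjections_apply, Matrix.sum_apply, map_sum]
    simp only [Matrix.smul_apply, map_smul, htrace, smul_eq_mul, mul_ite, mul_one,
      mul_zero, classicalFunctional_apply]
    by_cases h : i = j <;> simp [h]
  · ext1 i j
    have hconj (s w : Γ) : Unitary.conjStarAlgAut ℂ _ (τ s) (errorProjection τ (-(w + s)) i j) =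
        errorProjection τ (-w) i j := by
      rw [errorProjection, errorProjection, of_apply, of_apply, map_smul, ← StarAlgEquiv.mul_apply,
        ← hτ.conj_add, neg_add_rev, add_neg_cancel_left]
    simp only [starAlgHomOfProjections_apply, map_apply, Matrix.sum_apply, Matrix.smul_apply,
      adjacencyMap_neg_add_mem_apply, cayleyQuantumGraph_apply, map_sum, map_smul]
    simp only [Finset.sum_smul, Finset.smul_sum]
    refine Finset.sum_comm.trans (Eq.trans (Finset.sum_congr rfl fun s _ => ?_) Finset.sum_comm)
    refine Eq.trans ?_ (Equiv.sum_comp (Equiv.addRight s) _)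
    simp only [Equiv.coe_addRight, hconj]

end QuantumIsomorphism

end NiceErrorBases

namespace IsNiceErrorBasis

variable {n Γ : Type*} [Fintype n] [DecidableEq n] [AddGroup Γ] [Fintype Γ]
  {τ : Γ → unitary (Matrix n n ℂ)}

theorem conj_zero (hτ : IsNiceErrorBasis τ) : Unitary.conjStarAlgAut ℂ _ (τ 0) = 1 := by
  have h := hτ.conj_add 0 0
  rwa [add_zero, left_eq_mul] at h

theorem cayleyQuantumGraph_eq_axisGraph [DecidableEq Γ] (hτ : IsNiceErrorBasis τ) {z : Γ}
    (hz : z ≠ 0) (hherm : (τ z : Matrix n n ℂ).IsHermitian) (p q : Bool) :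
    cayleyQuantumGraph τ {v | v ≠ 0 ∧ if v = z then p else q} = axisGraph (τ z) p q := by
  refine LinearMap.ext fun x => ?_
  have hconj : Unitary.conjStarAlgAut ℂ _ (τ z) x = τ z * x * τ z := by
    rw [Unitary.conjStarAlgAut_apply, star_eq_conjTranspose, hherm.eq]
  have hterm (v : Γ) (y : Matrix n n ℂ) : (if v ≠ 0 ∧ (if v = z then p else q) then y else 0) =
      (if p then if v = z then y else 0 else 0) +
        if q then y - (if v = 0 then y else 0) - if v = z then y else 0 else 0 := by
    by_cases h0 : v = 0 <;> by_cases hvz : v = z <;> cases p <;> cases q <;> simp_all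
  rw [cayleyQuantumGraph_apply, Finset.sum_filter, axisGraph_apply]
  simp only [hterm]
  cases p <;> cases q <;>
    simp [-Unitary.conjStarAlgAut_apply, Finset.sum_sub_distrib, hτ.sum_conj, hτ.conj_zero, hconj]

end IsNiceErrorBasis

section PauliBasis

theorem pauli_mul_self (a : Fin 3) : pauli a * pauli a = 1 := by
  ext i j
  fin_cases a <;> fin_cases i <;> fin_cases j <;> simp [pauli]

/-- The Pauli matrix `pauli a` as a unitary. -/
def pauliUnitary (a : Fin 3) : unitary (Matrix (Fin 2) (Fin 2) ℂ) :=
  ⟨pauli a, by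
    rw [Unitary.mem_iff, star_eq_conjTranspose, (isHermitian_pauli a).eq, pauli_mul_self]
    exact ⟨rfl, rfl⟩⟩

/-- The error basis `1, σ_z, σ_x, σ_x σ_z` of `M_2`, indexed by `ℤ/2 × ℤ/2`. -/
def pauliBasis (v : ZMod 2 × ZMod 2) : unitary (Matrix (Fin 2) (Fin 2) ℂ) :=
  pauliUnitary 0 ^ v.1.val * pauliUnitary 2 ^ v.2.val

theorem pauliUnitary_mul_self (a : Fin 3) : pauliUnitary a * pauliUnitary a = 1 :=
  Subtype.ext (pauli_mul_self a)

theorem pauliUnitary_pow_val_add (a : Fin 3) (k l : ZMod 2) :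
    pauliUnitary a ^ (k + l).val = pauliUnitary a ^ k.val * pauliUnitary a ^ l.val := by
  rw [ZMod.val_add, ← pow_eq_pow_mod _ ((sq _).trans (pauliUnitary_mul_self a)), pow_add]

theorem conjStarAlgAut_pauliUnitary_apply (a : Fin 3) (x : Matrix (Fin 2) (Fin 2) ℂ) :
    Unitary.conjStarAlgAut ℂ _ (pauliUnitary a) x = pauli a * x * pauli a := by
  rw [Unitary.conjStarAlgAut_apply, pauliUnitary, star_eq_conjTranspose, (isHermitian_pauli a).eq]

theorem commute_conjStarAlgAut_pauliUnitary :
    Commute (Unitary.conjStarAlgAut ℂ _ (pauliUnitary 0))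
      (Unitary.conjStarAlgAut ℂ _ (pauliUnitary 2)) := by
  refine StarAlgEquiv.ext fun x => ?_
  rw [StarAlgEquiv.mul_apply, StarAlgEquiv.mul_apply]
  simp only [conjStarAlgAut_pauliUnitary_apply]
  rw [eta_fin_two x]
  ext i j
  fin_cases i <;> fin_cases j <;> simp [pauli]

theorem trace_pauliBasis {v : ZMod 2 × ZMod 2} (hv : v ≠ 0) :
    trace (pauliBasis v : Matrix (Fin 2) (Fin 2) ℂ) = 0 := by
  obtain ⟨a, b⟩ := v
  fin_cases a <;> fin_cases b
  · exact absurd rfl hv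
  all_goals
    simp [pauliBasis, pauliUnitary, pauli, trace_fin_two, ZMod.val]

theorem trace_pauliBasis_mul_star (v w : ZMod 2 × ZMod 2) :
    trace ((pauliBasis v : Matrix (Fin 2) (Fin 2) ℂ) * star (pauliBasis w : Matrix _ _ ℂ)) =
      trace (pauliBasis (w.1 + v.1, v.2 + w.2) : Matrix (Fin 2) (Fin 2) ℂ) := by
  have hstar (a : Fin 3) : star (pauliUnitary a) = pauliUnitary a :=
    Subtype.ext (isHermitian_pauli a).eq
  rw [← Unitary.coe_star, pauliBasis, pauliBasis, pauliBasis, star_mul, star_pow, star_pow,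
    hstar, hstar, pauliUnitary_pow_val_add, pauliUnitary_pow_val_add]
  simp only [Submonoid.coe_mul]
  rw [← Matrix.mul_assoc, trace_mul_comm]
  simp only [Matrix.mul_assoc]

theorem isNiceErrorBasis_pauliBasis : IsNiceErrorBasis pauliBasis where
  conj_add v w := by
    simp only [pauliBasis, Prod.fst_add, Prod.snd_add, pauliUnitary_pow_val_add, map_mul, map_pow]
    exact (commute_conjStarAlgAut_pauliUnitary.pow_pow _ _).mul_mul_mul_comm _ _
  trace_eq_zero v w h := by
    rw [trace_pauliBasis_mul_star]
    refine trace_pauliBasis fun h0 => h ?_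
    simp only [Prod.mk_eq_zero, CharTwo.add_eq_zero] at h0
    exact Prod.ext h0.1.symm h0.2
  card_eq := by simp

end PauliBasis

theorem exists_simpleGraph_fin_four_quantumIsomorphic_axisGraph (p q : Bool) :
    ∃ Δ : SimpleGraph (Fin 4),
      QuantumGraphQuantumIsomorphic (matrixFunctional (Fin 2)) (axisGraph (pauli 2) p q)
        (classicalFunctional (Fin 4)) (adjacencyMap Δ.Adj) ∧
      QuantumGraphQuantumIsomorphic (classicalFunctional (Fin 4)) (adjacencyMap Δ.Adj)
        (matrixFunctional (Fin 2)) (axisGraph (pauli 2) p q) := by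
  set S : Finset (ZMod 2 × ZMod 2) := {v | v ≠ 0 ∧ if v = (0, 1) then p else q}
  have hpauli : (pauliBasis (0, 1) : Matrix (Fin 2) (Fin 2) ℂ) = pauli 2 := by
    change pauli 0 ^ 0 * pauli 2 ^ 1 = pauli 2
    rw [pow_zero, pow_one, one_mul]
  have hcayley : cayleyQuantumGraph pauliBasis S = axisGraph (pauli 2) p q := by
    rw [← hpauli]
    exact isNiceErrorBasis_pauliBasis.cayleyQuantumGraph_eq_axisGraph (by decide)
      (hpauli ▸ isHermitian_pauli 2) p q
  let e : Fin 4 ≃ ZMod 2 × ZMod 2 := Fintype.equivOfCardEq (by simp)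
  let Δ : SimpleGraph (Fin 4) := (SimpleGraph.circulantGraph (S : Set (ZMod 2 × ZMod 2))).comap e
  have hΔ : QuantumGraphIsomorphic (classicalFunctional (ZMod 2 × ZMod 2))
      (adjacencyMap fun v w => -w + v ∈ S) (classicalFunctional (Fin 4)) (adjacencyMap Δ.Adj) :=
    adjacencyMap_isomorphic_of_equiv e fun v w => by
      have hneg : e w - e v = e v - e w := (neg_sub _ _).symm.trans
        (Prod.ext (ZMod.neg_eq_self_mod_two _) (ZMod.neg_eq_self_mod_two _))
      rw [SimpleGraph.comap_adj, SimpleGraph.circulantGraph_adj, hneg, or_self, Finset.mem_coe,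
        neg_add_eq_sub, ← ne_eq, ← sub_ne_zero, iff_and_self]
      exact fun h => (Finset.mem_filter.mp h).2.1
  rw [← hcayley]
  exact ⟨Δ, (isNiceErrorBasis_pauliBasis.cayleyQuantumGraph_quantumIsomorphic S).trans_isomorphic
    hΔ, hΔ.symm.trans_quantumIsomorphic
      (isNiceErrorBasis_pauliBasis.quantumIsomorphic_cayleyQuantumGraph S)⟩

/-! ### The voltage graph of a Pauli conjugation -/

section PermAction

variable {V Γ : Type*} [Group Γ] {σ : Γ →* Equiv.Perm V}

theorem permAction_apply (χ : Γ) (f : V → ℂ) (v : V) : permAction σ χ f v = f ((σ χ)⁻¹ v) := rfl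

theorem classicalFunctional_permAction [Fintype V] (χ : Γ) (f : V → ℂ) :
    classicalFunctional V (permAction σ χ f) = classicalFunctional V f := by
  simp only [classicalFunctional_apply, permAction_apply]
  exact Equiv.sum_comp _ f

theorem adjacencyMap_permAction [Fintype V] {r : V → V → Prop} {χ : Γ}
    (hr : ∀ v w, r (σ χ v) (σ χ w) ↔ r v w) (f : V → ℂ) :
    adjacencyMap r (permAction σ χ f) = permAction σ χ (adjacencyMap r f) := by
  classical
  ext w
  rw [permAction_apply, adjacencyMap_apply, adjacencyMap_apply, ← Equiv.sum_comp (σ χ)]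
  refine Finset.sum_congr rfl fun v _ => ?_
  rw [permAction_apply, ← Equiv.Perm.mul_apply, inv_mul_cancel, Equiv.Perm.one_apply]
  refine if_congr ?_ rfl rfl
  rw [← hr v, ← Equiv.Perm.mul_apply, mul_inv_cancel, Equiv.Perm.one_apply]

namespace CrossedProduct

variable (σ) in
/-- The element of the crossed product of `ℂ^V` by a permutation action which corresponds to a
matrix over `V`: the diagonal matrices are the functions on `V`, and the permutation matrices of the
action are the canonical unitaries. -/
def ofMatrix (x : Matrix V V ℂ) : CrossedProduct (permAction σ) :=
  fun χ w => x w (σ χ⁻¹ w)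

theorem ofMatrix_apply (x : Matrix V V ℂ) (χ : Γ) (w : V) :
    ofMatrix σ x χ w = x w (σ χ⁻¹ w) := rfl

theorem ofMatrix_star (x : Matrix V V ℂ) : ofMatrix σ (star x) = star (ofMatrix σ x) := by
  ext χ w
  rw [CrossedProduct.star_apply, permAction_apply, Pi.star_apply, ofMatrix_apply, ofMatrix_apply,
    ← map_inv, ← Equiv.Perm.mul_apply, ← map_mul, inv_mul_cancel, map_one, Equiv.Perm.one_apply]
  rfl

theorem ofMatrix_mul [Fintype V] [Fintype Γ] (hσ : ∀ v, Function.Bijective fun χ => σ χ v)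
    (x y : Matrix V V ℂ) :
    ofMatrix σ (x * y) = ofMatrix σ x * ofMatrix σ y := by
  ext χ w
  rw [CrossedProduct.mul_apply, Finset.sum_apply, ofMatrix_apply, Matrix.mul_apply,
    ← Equiv.sum_comp ((Equiv.inv Γ).trans (Equiv.ofBijective _ (hσ w)))]
  refine Finset.sum_congr rfl fun ξ _ => ?_
  rw [Pi.mul_apply, permAction_apply, ofMatrix_apply, ofMatrix_apply, ← map_inv,
    ← Equiv.Perm.mul_apply, ← map_mul, _root_.mul_inv_rev, inv_inv, mul_assoc, mul_inv_cancel,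
    mul_one]
  rfl

end CrossedProduct

open CrossedProduct

variable [Fintype V] [Fintype Γ]

/-- The matrix algebra over `V` as the crossed product of `ℂ^V` by a regular permutation action. -/
def matrixEquivCrossedProduct (hσ : ∀ v, Function.Bijective fun χ => σ χ v) :
    Matrix V V ℂ ≃⋆ₐ[ℂ] CrossedProduct (permAction σ) :=
  let e (w : V) : Γ ≃ V := (Equiv.inv Γ).trans (Equiv.ofBijective _ (hσ w))
  { toFun := ofMatrix σ
    invFun := fun y => of fun w v => y ((e w).symm v) w
    left_inv := fun x => by
      ext w v
      exact congrArg (x w) ((e w).apply_symm_apply v)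
    right_inv := fun y => by
      ext χ w
      exact congrFun (congrArg y ((e w).symm_apply_apply χ)) w
    map_mul' := ofMatrix_mul hσ
    map_add' := fun x y => rfl
    map_star' := ofMatrix_star
    map_smul' := fun c x => rfl }

theorem matrixEquivCrossedProduct_apply (hσ : ∀ v, Function.Bijective fun χ => σ χ v)
    (x : Matrix V V ℂ) (χ : Γ) (w : V) :
    matrixEquivCrossedProduct hσ x χ w = x w (σ χ⁻¹ w) := rfl

theorem functional_matrixEquivCrossedProduct [Nonempty V]
    (hσ : ∀ v, Function.Bijective fun χ => σ χ v) (x : Matrix V V ℂ) :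
    CrossedProduct.functional (permAction σ) (classicalFunctional V)
      (matrixEquivCrossedProduct hσ x) = matrixFunctional V x := by
  have hcard : Fintype.card Γ = Fintype.card V :=
    Fintype.card_of_bijective (hσ (Classical.arbitrary V))
  rw [CrossedProduct.functional_apply, classicalFunctional_apply, matrixFunctional_apply, hcard]
  simp only [matrixEquivCrossedProduct_apply, inv_one, map_one, Equiv.Perm.one_apply]
  rfl

end PermAction

section TwoVertices

theorem swapHom_one : swapHom 1 = 1 := map_one _

theorem swapHom_of_ne_one {χ : DualGroup (ZMod 2)} (hχ : χ ≠ 1) : swapHom χ = Equiv.swap 0 1 :=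
  if_neg hχ

theorem bijective_swapHom_apply (v : Fin 2) : Function.Bijective fun χ => swapHom χ v := by
  have hcard : Fintype.card (DualGroup (ZMod 2)) = Fintype.card (Fin 2) := by
    rw [AddChar.card_eq, ZMod.card, Fintype.card_fin]
  refine (Fintype.bijective_iff_surjective_and_card _).2 ⟨fun w => ?_, hcard⟩
  by_cases hwv : w = v
  · exact ⟨1, by simp only [swapHom_one, hwv, Equiv.Perm.one_apply]⟩
  · have : Nontrivial (DualGroup (ZMod 2)) := Fintype.one_lt_card_iff_nontrivial.1 (by simp [hcard])
    obtain ⟨χ, hχ⟩ := exists_ne (1 : DualGroup (ZMod 2))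
    refine ⟨χ, ?_⟩
    dsimp only
    rw [swapHom_of_ne_one hχ]
    revert v w
    decide

/-- The `ℤ/2`-voltage graph on two vertices with a loop labelled `1` at each vertex (if `p`) and
edges in both directions with both labels between the vertices (if `q`). -/
def twoVertexVoltageGraph (p q : Bool) : VoltageGraph (Fin 2) (ZMod 2) where
  E := {e : Fin 2 × Fin 2 × ZMod 2 // if e.1 = e.2.1 then e.2.2 = 1 ∧ p else q}
  finite_edges := inferInstance
  s e := e.1.1
  t e := e.1.2.1
  label e := e.1.2.2

theorem preSimple_twoVertexVoltageGraph (p q : Bool) : (twoVertexVoltageGraph p q).PreSimple :=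
  fun _ _ hs ht hlabel => Subtype.ext (Prod.ext hs (Prod.ext ht hlabel))

theorem twoVertexVoltageGraph_adjacency (p q : Bool) (g : ZMod 2) :
    (twoVertexVoltageGraph p q).adjacency g =
      adjacencyMap fun v w => if v = w then g = 1 ∧ p else q := by
  refine congrArg adjacencyMap <| funext₂ fun v w =>
    propext ⟨?_, fun h => ⟨⟨(v, w, g), h⟩, rfl, rfl, rfl⟩⟩
  rintro ⟨e, rfl, rfl, rfl⟩
  exact e.2

theorem twoVertexVoltageGraph_adjacency_apply (p q : Bool) (g : ZMod 2) (f : Fin 2 → ℂ)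
    (w : Fin 2) :
    (twoVertexVoltageGraph p q).adjacency g f w =
      (if g = 1 ∧ p then f w else 0) + if q then f (Equiv.swap 0 1 w) else 0 := by
  rw [twoVertexVoltageGraph_adjacency, adjacencyMap_apply, Fin.sum_univ_two]
  fin_cases w
  · simp
  · simp [add_comm]

theorem twoVertexVoltageGraph_adjacency_swapAction (p q : Bool) (g : ZMod 2)
    (χ : DualGroup (ZMod 2)) (f : Fin 2 → ℂ) :
    (twoVertexVoltageGraph p q).adjacency g (swapAction χ f) =
      swapAction χ ((twoVertexVoltageGraph p q).adjacency g f) := by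
  rw [twoVertexVoltageGraph_adjacency]
  exact adjacencyMap_permAction (fun v w => by simp only [(swapHom χ).injective.eq_iff]) f

theorem isVoltageQuantumGraph_twoVertexVoltageGraph (p q : Bool) :
    IsVoltageQuantumGraph (classicalFunctional (Fin 2)) swapAction
      (twoVertexVoltageGraph p q).adjacency where
  isQuantumSet := isQuantumSet_classicalFunctional
  functional_act := classicalFunctional_permAction
  isQuantumGraph _ := isQuantumGraph_adjacencyMap _
  commute_act := twoVertexVoltageGraph_adjacency_swapAction p q

/-- The identification of the algebra of a qubit with the crossed product of `ℂ²` by the swap. -/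
def qubitEquivCrossedProduct : Matrix (Fin 2) (Fin 2) ℂ ≃⋆ₐ[ℂ] CrossedProduct swapAction :=
  matrixEquivCrossedProduct bijective_swapHom_apply

theorem qubitEquivCrossedProduct_apply (x : Matrix (Fin 2) (Fin 2) ℂ) (χ : DualGroup (ZMod 2))
    (w : Fin 2) : qubitEquivCrossedProduct x χ w = x w (swapHom χ⁻¹ w) := rfl

theorem functional_qubitEquivCrossedProduct (x : Matrix (Fin 2) (Fin 2) ℂ) :
    CrossedProduct.functional swapAction (classicalFunctional (Fin 2))
      (qubitEquivCrossedProduct x) = matrixFunctional (Fin 2) x :=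
  functional_matrixEquivCrossedProduct bijective_swapHom_apply x

theorem pauli_two_mul_mul_apply (x : Matrix (Fin 2) (Fin 2) ℂ) (i j : Fin 2) :
    (pauli 2 * x * pauli 2) i j = if i = j then x i j else -x i j := by
  rw [eta_fin_two x]
  fin_cases i <;> fin_cases j <;> simp [pauli]

theorem sum_zmod_two {M : Type*} [AddCommMonoid M] (f : ZMod 2 → M) : ∑ g, f g = f 0 + f 1 :=
  Fin.sum_univ_two f

theorem DualGroup.apply_one_eq_neg_one {χ : DualGroup (ZMod 2)} (hχ : χ ≠ 1) : χ 1 = -1 := by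
  have hsum := AddChar.sum_eq_zero_of_ne_one hχ
  rw [sum_zmod_two, AddChar.map_zero_eq_one] at hsum
  exact (neg_eq_of_add_eq_zero_right hsum).symm

theorem derivedQuantumGraph_qubitEquivCrossedProduct (p q : Bool)
    (x : Matrix (Fin 2) (Fin 2) ℂ) :
    derivedQuantumGraph (classicalFunctional (Fin 2)) swapAction
      (twoVertexVoltageGraph p q).adjacency (qubitEquivCrossedProduct x) =
      qubitEquivCrossedProduct (axisGraph (pauli 2) p q x) := by
  have hinv (χ : DualGroup (ZMod 2)) (f : Fin 2 → ℂ) :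
      classicalFunctional (Fin 2) (swapAction χ f) = classicalFunctional (Fin 2) f :=
    classicalFunctional_permAction χ f
  ext χ w
  rw [derivedQuantumGraph_apply isDualFrame_classicalFunctional classicalFunctional_star
    hinv (twoVertexVoltageGraph_adjacency_swapAction p q),
    qubitEquivCrossedProduct_apply, sum_zmod_two, Pi.add_apply, Pi.smul_apply, Pi.smul_apply,
    twoVertexVoltageGraph_adjacency_apply, twoVertexVoltageGraph_adjacency_apply, axisGraph_apply]
  simp only [qubitEquivCrossedProduct_apply, AddChar.map_zero_eq_one]
  rcases eq_or_ne χ 1 with rfl | hχ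
  · rw [AddChar.one_apply, inv_one, swapHom_one]
    fin_cases w <;> cases p <;> cases q <;>
      simp [pauli_two_mul_mul_apply, matrixFunctional_apply, trace_fin_two] <;> ring
  · rw [DualGroup.apply_one_eq_neg_one hχ, swapHom_of_ne_one (inv_ne_one.2 hχ)]
    fin_cases w <;> cases p <;> cases q <;>
      simp [pauli_two_mul_mul_apply, matrixFunctional_apply, trace_fin_two]

end TwoVertices

end

theorem mainTheorem5 (A : Matrix (Fin 2) (Fin 2) ℂ →ₗ[ℂ] Matrix (Fin 2) (Fin 2) ℂ)
    (hA : IsQuantumGraph twoTrace A) (hund : IsUndirected twoTrace A)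
    (hloop : IsLoopfree twoTrace A) :
    (∃ Γ : VoltageGraph (Fin 2) (ZMod 2), Γ.PreSimple ∧
      IsVoltageQuantumGraph (classicalFunctional (Fin 2)) swapAction Γ.adjacency ∧
      IsQuantumSet (CrossedProduct.functional swapAction (classicalFunctional (Fin 2))) ∧
      IsQuantumGraph (CrossedProduct.functional swapAction (classicalFunctional (Fin 2)))
        (derivedQuantumGraph (classicalFunctional (Fin 2)) swapAction Γ.adjacency) ∧
      QuantumGraphIsomorphic twoTrace A
        (CrossedProduct.functional swapAction (classicalFunctional (Fin 2)))
        (derivedQuantumGraph (classicalFunctional (Fin 2)) swapAction Γ.adjacency)) ∧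
    (∃ Δ : SimpleGraph (Fin 4),
      QuantumGraphQuantumIsomorphic twoTrace A
        (classicalFunctional (Fin 4)) (adjacencyMap Δ.Adj) ∧
      QuantumGraphQuantumIsomorphic (classicalFunctional (Fin 4)) (adjacencyMap Δ.Adj)
        twoTrace A) := by
  rw [twoTrace_eq_matrixFunctional] at hA hund hloop ⊢
  obtain ⟨p, q, haxis⟩ := exists_isomorphic_axisGraph hA hund hloop
  obtain ⟨Δ, hΔ, hΔ'⟩ := exists_simpleGraph_fin_four_quantumIsomorphic_axisGraph p q
  obtain ⟨φ, hφ, hφA⟩ := haxis.trans ⟨qubitEquivCrossedProduct, functional_qubitEquivCrossedProduct,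
    fun x => (derivedQuantumGraph_qubitEquivCrossedProduct p q x).symm⟩
  exact ⟨⟨twoVertexVoltageGraph p q, preSimple_twoVertexVoltageGraph p q,
      isVoltageQuantumGraph_twoVertexVoltageGraph p q,
      isQuantumSet_matrixFunctional.map isDualFrame_matrixFunctional matrixFunctional_star hφ,
      hA.map isDualFrame_matrixFunctional matrixFunctional_star hφ hφA,
      ⟨φ, hφ, hφA⟩⟩,
    Δ, haxis.trans_quantumIsomorphic hΔ, hΔ'.trans_isomorphic haxis.symm⟩
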